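/- Let $F$ be a field with separable closure $F_s$ and algebraic closure $\bar F$. Let $G$ be an algebraic group over $F$, i.e. a smooth affine group scheme of finite type over $F$, and let $V$ be a finite-dimensional representation of $G$ over $F$ that is small, meaning that $G$ has an open orbit $U$ in $\mathbb{P}(V)$ (that is, $U\subset\mathbb{P}(V)(\bar F)$ is a Zariski open $G(\bar F)$-orbit). Suppose that $F$ is infinite or that $G$ is connected. Let $x\in\mathbb{P}(V)(F)$ be an $F$-point lying in $U$, and let $H\subset G$ be the stabilizer of $x$; if $F$ is not perfect, assume that the (scheme-theoretic) stabilizer $H$ is smooth. Then the natural map in Galois cohomology $$H^1(F,H)\longrightarrow H^1(F,G)$$ is surjective. Here $H^1(F,G)$ is the set of continuous 1-cocycles of $\mathrm{Gal}(F_s/F)$ with values in the discrete group $G(F_s)$, modulo the relation $z\sim z'$ if $z'_\sigma=g^{-1}z_\sigma\,\sigma(g)$ for some $g\in G(F_s)$ and all $\sigma$; likewise for $H^1(F,H)$ with $H(F_s)=\{g\in G(F_s): gx=x\}$. -/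

import Mathlib

open scoped TensorProduct LinearAlgebra.Projectivization

noncomputable section

/-! ### Non-abelian first cohomology -/

section Cohomology

variable (Γ M : Type*) [Group Γ] [TopologicalSpace Γ] [Group M] [MulDistribMulAction Γ M]

/-- Continuous 1-cocycles of a topological group `Γ` with values in a (not necessarily commutative)
discrete group `M` on which `Γ` acts by automorphisms. -/
structure OneCocycle where
  /-- the underlying function -/
  toFun : Γ → M
  isLocallyConstant : IsLocallyConstant toFun
  map_mul : ∀ σ τ : Γ, toFun (σ * τ) = toFun σ * σ • toFun τ

/-- Two cocycles `z`, `z'` are cohomologous if `z'_σ = m⁻¹ z_σ σ(m)` for some `m` in `M`. -/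
instance oneCocycleSetoid : Setoid (OneCocycle Γ M) where
  r z z' := ∃ m : M, ∀ σ : Γ, z'.toFun σ = m⁻¹ * z.toFun σ * σ • m
  iseqv :=
    { refl := fun z => ⟨1, fun σ => by simp⟩
      symm := by
        rintro z z' ⟨m, hm⟩
        refine ⟨m⁻¹, fun σ => ?_⟩
        rw [hm σ, smul_inv']
        group
      trans := by
        rintro z z' z'' ⟨m, hm⟩ ⟨n, hn⟩
        refine ⟨m * n, fun σ => ?_⟩
        rw [hn σ, hm σ, smul_mul']
        group }

/-- The pointed set `H¹(Γ, M)`. -/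
def NonabelianH1 : Type _ := Quotient (oneCocycleSetoid Γ M)

variable {Γ M} {N : Type*} [Group N] [MulDistribMulAction Γ N]

/-- The cocycle obtained from a cocycle by a `Γ`-equivariant homomorphism of coefficients. -/
def OneCocycle.map (f : N →* M) (hf : ∀ (σ : Γ) (n : N), f (σ • n) = σ • f n)
    (z : OneCocycle Γ N) : OneCocycle Γ M where
  toFun σ := f (z.toFun σ)
  isLocallyConstant := z.isLocallyConstant.comp f
  map_mul σ τ := by rw [z.map_mul, _root_.map_mul, hf]

/-- The map `H¹(Γ, N) → H¹(Γ, M)` induced by a `Γ`-equivariant homomorphism `N → M`. -/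
def NonabelianH1.map (f : N →* M) (hf : ∀ (σ : Γ) (n : N), f (σ • n) = σ • f n) :
    NonabelianH1 Γ N → NonabelianH1 Γ M :=
  Quotient.map (OneCocycle.map f hf) (by
    rintro z z' ⟨n, hn⟩
    refine ⟨f n, fun σ => ?_⟩
    change f (z'.toFun σ) = (f n)⁻¹ * f (z.toFun σ) * σ • f n
    rw [hn σ, _root_.map_mul, _root_.map_mul, map_inv, hf])

end Cohomology

/-! ### Affine algebraic groups, through their coordinate Hopf algebras -/

section Points

variable (F A K : Type*) [Field F] [CommRing A] [HopfAlgebra F A] [CommRing K] [Algebra F K]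

/-- The group `G(K)` of `K`-points of the affine group scheme `G = Spec A`: the `F`-algebra
homomorphisms `A → K`, with the convolution product. -/
abbrev GroupPoints : Type _ := WithConv (A →ₐ[F] K)

variable {F A K}

/-- Inverses in `G(K)` are given by composition with the antipode. -/
instance groupPointsGroup : Group (GroupPoints F A K) where
  inv g := WithConv.toConv (g.ofConv.comp (HopfAlgebra.antipodeAlgHom F A))
  inv_mul_cancel g := by
    apply WithConv.ofConv_injective
    ext a
    have key : ∀ t : A ⊗[F] A, Algebra.TensorProduct.lift
        (g.ofConv.comp (HopfAlgebra.antipodeAlgHom F A)) g.ofConv (fun _ _ => .all ..) t =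
          g.ofConv (LinearMap.mul' F A ((HopfAlgebra.antipode F (A := A)).rTensor A t)) := by
      intro t
      induction t with
      | zero => simp
      | add s t hs ht => simp only [map_add, hs, ht]
      | tmul b c => simp
    refine (AlgHom.convMul_apply _ g a).trans ((key _).trans ?_)
    rw [HopfAlgebra.mul_antipode_rTensor_comul_apply]
    exact g.ofConv.commutes _

/-- Automorphisms of `K` over `F` act on `G(K)` by composition. -/
instance groupPointsAction : MulDistribMulAction (K ≃ₐ[F] K) (GroupPoints F A K) where
  smul σ g := WithConv.toConv ((σ : K →ₐ[F] K).comp g.ofConv)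
  one_smul g := by
    apply WithConv.ofConv_injective
    ext a
    rfl
  mul_smul σ τ g := by
    apply WithConv.ofConv_injective
    ext a
    rfl
  smul_mul σ g h := by
    apply WithConv.ofConv_injective
    exact AlgHom.comp_convMul_distrib (σ : K →ₐ[F] K) g h
  smul_one σ := by
    apply WithConv.ofConv_injective
    ext a
    change σ (algebraMap F K _) = algebraMap F K _
    simp

end Points

/-! ### Representations -/

/-- A (linear, algebraic) representation of `G = Spec A` on the `F`-vector space `V`, given by its
coaction `V → V ⊗ A`. -/
structure GroupRep (F A V : Type*) [Field F] [CommRing A] [HopfAlgebra F A]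
    [AddCommGroup V] [Module F V] where
  /-- the coaction -/
  coact : V →ₗ[F] V ⊗[F] A
  coassoc : (TensorProduct.assoc F V A A).toLinearMap ∘ₗ coact.rTensor A ∘ₗ coact =
    (Coalgebra.comul (R := F) (A := A)).lTensor V ∘ₗ coact
  counit : (TensorProduct.rid F V).toLinearMap ∘ₗ
    (Coalgebra.counit (R := F) (A := A)).lTensor V ∘ₗ coact = LinearMap.id

namespace GroupRep

variable {F A V : Type*} [Field F] [CommRing A] [HopfAlgebra F A]
  [AddCommGroup V] [Module F V] (ρ : GroupRep F A V)

section Action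

variable {K : Type*} [CommRing K] [Algebra F K]

/-- For `g` in `G(K)`, the `F`-linear map `V → K ⊗ V`, `v ↦ g · v`. If the coaction sends `v` to
`∑ vᵢ ⊗ aᵢ`, then `g · v = ∑ g(aᵢ) ⊗ vᵢ`. -/
def actOn (g : GroupPoints F A K) : V →ₗ[F] K ⊗[F] V :=
  (TensorProduct.comm F V K).toLinearMap ∘ₗ g.ofConv.toLinearMap.lTensor V ∘ₗ ρ.coact

/-- The `K`-linear endomorphism of `K ⊗ V` by which `g` in `G(K)` acts. -/
def act (g : GroupPoints F A K) : Module.End K (K ⊗[F] V) :=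
  (ρ.actOn g).liftBaseChange K

theorem act_tmul (g : GroupPoints F A K) (k : K) (v : V) :
    ρ.act g (k ⊗ₜ v) = k • ρ.actOn g v := by
  simp [act]

theorem act_one : ρ.act (1 : GroupPoints F A K) = 1 := by
  apply TensorProduct.AlgebraTensorModule.curry_injective
  ext v
  have h := LinearMap.congr_fun ρ.counit v
  have key : ∀ t : V ⊗[F] A,
      TensorProduct.comm F V K ((1 : GroupPoints F A K).ofConv.toLinearMap.lTensor V t) =
        (1 : K) ⊗ₜ[F] (TensorProduct.rid F V
          ((Coalgebra.counit (R := F) (A := A)).lTensor V t)) := by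
    intro t
    induction t with
    | zero => simp
    | add s t hs ht => simp only [map_add, hs, ht, TensorProduct.tmul_add]
    | tmul w a =>
      simp only [LinearMap.lTensor_tmul, TensorProduct.comm_tmul, TensorProduct.rid_tmul]
      change algebraMap F K (Coalgebra.counit (R := F) a) ⊗ₜ[F] w = _
      rw [Algebra.algebraMap_eq_smul_one, TensorProduct.smul_tmul]
  change ρ.act 1 ((1 : K) ⊗ₜ v) = (1 : K) ⊗ₜ v
  rw [act_tmul, one_smul]
  exact (key (ρ.coact v)).trans (congrArg _ h)

theorem act_mul (g h : GroupPoints F A K) : ρ.act (g * h) = ρ.act g * ρ.act h := by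
  apply TensorProduct.AlgebraTensorModule.curry_injective
  ext v
  change ρ.act (g * h) ((1 : K) ⊗ₜ v) = ρ.act g (ρ.act h ((1 : K) ⊗ₜ v))
  rw [act_tmul, act_tmul, one_smul, one_smul]
  let m : V ⊗[F] (A ⊗[F] A) →ₗ[F] K ⊗[F] V :=
    (TensorProduct.comm F V K).toLinearMap ∘ₗ
      ((LinearMap.mul' F K) ∘ₗ
        TensorProduct.map g.ofConv.toLinearMap h.ofConv.toLinearMap).lTensor V
  have h1 : ρ.actOn (g * h) v =
      m ((Coalgebra.comul (R := F) (A := A)).lTensor V (ρ.coact v)) := by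
    generalize hx : ρ.coact v = t
    change TensorProduct.comm F V K
      ((g * h).ofConv.toLinearMap.lTensor V (ρ.coact v)) = _
    rw [hx]
    clear hx
    induction t with
    | zero => simp
    | add s t hs ht => simp only [map_add, hs, ht]
    | tmul w a =>
      simp only [m, LinearMap.lTensor_tmul, LinearMap.comp_apply, LinearEquiv.coe_coe]
      rfl
  have h2 : ∀ t : V ⊗[F] A, ρ.act g (TensorProduct.comm F V K
      (h.ofConv.toLinearMap.lTensor V t)) =
        m (TensorProduct.assoc F V A A (ρ.coact.rTensor A t)) := by
    intro t
    induction t with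
    | zero => simp
    | add s t hs ht => simp only [map_add, hs, ht]
    | tmul w a =>
      simp only [LinearMap.lTensor_tmul, TensorProduct.comm_tmul, LinearMap.rTensor_tmul]
      rw [act_tmul]
      change h.ofConv a • TensorProduct.comm F V K
        (g.ofConv.toLinearMap.lTensor V (ρ.coact w)) = _
      generalize ρ.coact w = s
      induction s with
      | zero => simp
      | add s t hs ht => simp only [map_add, smul_add, hs, ht, TensorProduct.add_tmul]
      | tmul u b =>
        simp [m, TensorProduct.smul_tmul', mul_comm]
  rw [h1]
  exact (congrArg m (LinearMap.congr_fun ρ.coassoc v)).symm.trans (h2 (ρ.coact v)).symm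

/-- The action is compatible with the Galois action. -/
theorem actOn_smul (σ : K ≃ₐ[F] K) (g : GroupPoints F A K) (v : V) :
    ρ.actOn (σ • g) v = (σ : K →ₐ[F] K).toLinearMap.rTensor V (ρ.actOn g v) := by
  change TensorProduct.comm F V K ((σ • g).ofConv.toLinearMap.lTensor V (ρ.coact v)) =
    (σ : K →ₐ[F] K).toLinearMap.rTensor V
      (TensorProduct.comm F V K (g.ofConv.toLinearMap.lTensor V (ρ.coact v)))
  generalize ρ.coact v = t
  induction t with
  | zero => simp
  | add s t hs ht => simp only [map_add, hs, ht]
  | tmul w a => rfl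

/-- The homomorphism `G(K) → GL(K ⊗ V)`. -/
def toGL : GroupPoints F A K →* LinearMap.GeneralLinearGroup K (K ⊗[F] V) :=
  MonoidHom.toHomUnits
    { toFun := ρ.act
      map_one' := ρ.act_one
      map_mul' := ρ.act_mul }

end Action

end GroupRep

/-! ### Projective space -/

section Projective

/-- The inclusion `ℙ(V)(F) → ℙ(V)(K) = ℙ(K ⊗ V)`, `[v] ↦ [1 ⊗ v]`. -/
def projBaseChange {F V : Type*} [Field F] [AddCommGroup V] [Module F V] (K : Type*) [Field K]
    [Algebra F K] : ℙ F V → ℙ K (K ⊗[F] V) :=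
  Projectivization.map (σ := algebraMap F K)
    { toFun := fun v => (1 : K) ⊗ₜ[F] v
      map_add' := fun v w => TensorProduct.tmul_add _ _ _
      map_smul' := fun a v => by
        rw [TensorProduct.tmul_smul, algebraMap_smul] }
    (Module.FaithfullyFlat.tensorProduct_mk_injective (A := F) (B := K) V)

variable {K W : Type*} [Field K] [AddCommGroup W] [Module K W]

/-- A subset of `ℙ(W)` is Zariski closed if it is the common zero locus of a set of homogeneous
polynomials in linear forms on `W`. -/
def IsZariskiClosed (S : Set (ℙ K W)) : Prop :=
  ∃ I : Set (MvPolynomial (Module.Dual K W) K),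
    (∀ f ∈ I, ∃ d : ℕ, f.IsHomogeneous d) ∧
    S = {p | ∀ f ∈ I, ∀ w ∈ p.submodule, MvPolynomial.eval (fun φ => φ w) f = 0}

/-- A subset of `ℙ(W)` is Zariski open if its complement is Zariski closed. -/
def IsZariskiOpen (S : Set (ℙ K W)) : Prop := IsZariskiClosed Sᶜ

end Projective

namespace GroupRep

variable {F A V : Type*} [Field F] [CommRing A] [HopfAlgebra F A]
  [AddCommGroup V] [Module F V] (ρ : GroupRep F A V)

/-- `U` is an open orbit of `G` in `ℙ(V)` (on points over the algebraic closure of `F`). -/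
def IsOpenOrbit (U : Set (ℙ (AlgebraicClosure F) (AlgebraicClosure F ⊗[F] V))) : Prop :=
  (∃ p, U = Set.range fun g : GroupPoints F A (AlgebraicClosure F) => ρ.toGL g • p) ∧
    IsZariskiOpen U

/-- The representation is small if `G` has an open orbit in `ℙ(V)`. -/
def IsSmall : Prop := ∃ U, ρ.IsOpenOrbit U

/-- The ideal of `A` that defines the scheme-theoretic stabilizer `H` of `x` in `ℙ(V)(F)`: it is
generated by the matrix coefficients `g ↦ φ(g · v)` with `v` in the line `x` and `φ` a linear form
that vanishes on `x`. Hence `A ⧸ ρ.stabilizerIdeal x` is the coordinate ring of `H`. -/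
def stabilizerIdeal (x : ℙ F V) : Ideal A :=
  Ideal.span {a | ∃ v ∈ x.submodule, ∃ φ ∈ x.submodule.dualAnnihilator,
    a = TensorProduct.lid F A (φ.rTensor A (ρ.coact v))}

/-- The group `H(K)` of elements of `G(K)` that stabilize the `F`-point `x` of `ℙ(V)`. -/
def stabilizer (x : ℙ F V) (K : Type*) [Field K] [Algebra F K] :
    Subgroup (GroupPoints F A K) :=
  (MulAction.stabilizer (LinearMap.GeneralLinearGroup K (K ⊗[F] V))
    (projBaseChange K x)).comap ρ.toGL

variable {ρ} {K : Type*} [Field K] [Algebra F K]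

theorem mem_stabilizer_mk {v : V} (hv : v ≠ 0) {g : GroupPoints F A K} :
    g ∈ ρ.stabilizer (Projectivization.mk F v hv) K ↔
      ∃ k : K, k • ((1 : K) ⊗ₜ[F] v) = ρ.actOn g v := by
  have h0 : (1 : K) ⊗ₜ[F] v ≠ 0 := fun h => hv
    (Module.FaithfullyFlat.tensorProduct_mk_injective (A := F) (B := K) V (by simpa using h))
  have h1 : projBaseChange K (Projectivization.mk F v hv) = Projectivization.mk K _ h0 := rfl
  rw [stabilizer, Subgroup.mem_comap, MulAction.mem_stabilizer_iff, h1,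
    Projectivization.smul_mk, Projectivization.mk_eq_mk_iff']
  have h2 : ρ.toGL g • ((1 : K) ⊗ₜ[F] v) = ρ.actOn g v := by
    change ρ.act g ((1 : K) ⊗ₜ[F] v) = _
    rw [act_tmul, one_smul]
  rw [h2]

/-- `H(K)` is stable under the automorphisms of `K` over `F`. -/
theorem smul_mem_stabilizer {x : ℙ F V} (σ : K ≃ₐ[F] K) {g : GroupPoints F A K}
    (hg : g ∈ ρ.stabilizer x K) : σ • g ∈ ρ.stabilizer x K := by
  induction x using Projectivization.ind with
  | h v hv =>
    rw [mem_stabilizer_mk] at hg ⊢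
    obtain ⟨k, hk⟩ := hg
    refine ⟨σ k, ?_⟩
    rw [actOn_smul, ← hk]
    simp [TensorProduct.smul_tmul']

theorem apply_matrixCoeff (g : GroupPoints F A K) (φ : Module.Dual F V) (v : V) :
    g.ofConv (TensorProduct.lid F A (φ.rTensor A (ρ.coact v))) =
      TensorProduct.rid F K (φ.lTensor K (ρ.actOn g v)) := by
  change _ = TensorProduct.rid F K (φ.lTensor K (TensorProduct.comm F V K
    (g.ofConv.toLinearMap.lTensor V (ρ.coact v))))
  generalize ρ.coact v = t
  induction t with
  | zero => simp
  | add s t hs ht => simp only [map_add, hs, ht]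
  | tmul w a => simp

/-- A point `g` of `G(K)` stabilizes `x` if and only if it is a point of the closed subscheme
defined by `ρ.stabilizerIdeal x`. -/
theorem mem_stabilizer_iff {x : ℙ F V} {g : GroupPoints F A K} :
    g ∈ ρ.stabilizer x K ↔ ∀ a ∈ ρ.stabilizerIdeal x, g.ofConv a = 0 := by
  induction x using Projectivization.ind with
  | h v hv =>
    have hker : (∀ a ∈ ρ.stabilizerIdeal (Projectivization.mk F v hv), g.ofConv a = 0) ↔
        ∀ φ : Module.Dual F V, φ v = 0 →
          TensorProduct.rid F K (φ.lTensor K (ρ.actOn g v)) = 0 := by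
      constructor
      · intro h φ hφ
        rw [← apply_matrixCoeff]
        refine h _ (Ideal.subset_span ⟨v, ?_, φ, ?_, rfl⟩)
        · rw [Projectivization.submodule_mk]
          exact Submodule.mem_span_singleton_self v
        · rw [Projectivization.submodule_mk, Submodule.mem_dualAnnihilator]
          intro w hw
          obtain ⟨c, rfl⟩ := Submodule.mem_span_singleton.mp hw
          simp [hφ]
      · intro h
        have : ρ.stabilizerIdeal (Projectivization.mk F v hv) ≤ RingHom.ker g.ofConv := by
          refine Ideal.span_le.mpr ?_
          rintro a ⟨w, hw, φ, hφ, rfl⟩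
          rw [Projectivization.submodule_mk] at hw hφ
          obtain ⟨c, rfl⟩ := Submodule.mem_span_singleton.mp hw
          have hφv := (Submodule.mem_dualAnnihilator φ).mp hφ v
            (Submodule.mem_span_singleton_self v)
          change g.ofConv _ = 0
          rw [apply_matrixCoeff, map_smul, map_smul, map_smul, h φ hφv, smul_zero]
        exact fun a ha => this ha
    rw [hker, mem_stabilizer_mk]
    constructor
    · rintro ⟨k, hk⟩ φ hφ
      rw [← hk]
      simp [TensorProduct.smul_tmul', hφ]
    · intro h
      obtain ⟨ψ, hψ⟩ : ∃ ψ : Module.Dual F V, ψ v = 1 := by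
        obtain ⟨ψ, hψ⟩ := Module.Projective.exists_dual_ne_zero F hv
        exact ⟨(ψ v)⁻¹ • ψ, by simp [hψ]⟩
      let π : V →ₗ[F] V := LinearMap.id - ψ.smulRight v
      have hπ : π v = 0 := by simp [π, hψ]
      have h0 : π.lTensor K (ρ.actOn g v) = 0 := by
        let b := Module.Basis.ofVectorSpace F V
        apply (b.baseChange K).ext_elem
        intro i
        have hi : ∀ z : K ⊗[F] V, (b.baseChange K).repr z i =
            TensorProduct.rid F K ((b.coord i).lTensor K z) := by
          intro z
          induction z with
          | zero => simp
          | add s t hs ht => simp only [map_add, Finsupp.add_apply, hs, ht]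
          | tmul k w => simp
        rw [hi, map_zero, ← LinearMap.lTensor_comp_apply, h _ (by simp [hπ])]
        simp
      refine ⟨TensorProduct.rid F K (ψ.lTensor K (ρ.actOn g v)), ?_⟩
      have hz : ∀ z : K ⊗[F] V, π.lTensor K z =
          z - TensorProduct.rid F K (ψ.lTensor K z) • ((1 : K) ⊗ₜ[F] v) := by
        intro z
        induction z with
        | zero => simp
        | add s t hs ht =>
          simp only [map_add, hs, ht, add_smul]
          abel
        | tmul k w =>
          simp [π, TensorProduct.smul_tmul', TensorProduct.tmul_smul]
      rw [hz, sub_eq_zero] at h0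
      exact h0.symm

instance stabilizerAction (x : ℙ F V) :
    MulDistribMulAction (K ≃ₐ[F] K) (ρ.stabilizer x K) where
  smul σ g := ⟨σ • (g : GroupPoints F A K), smul_mem_stabilizer σ g.2⟩
  one_smul g := Subtype.ext (one_smul _ (g : GroupPoints F A K))
  mul_smul σ τ g := Subtype.ext (mul_smul σ τ (g : GroupPoints F A K))
  smul_mul σ g h := Subtype.ext (smul_mul' σ (g : GroupPoints F A K) h)
  smul_one σ := Subtype.ext (MulDistribMulAction.smul_one σ)

variable (ρ)

/-- The natural map `H¹(F, H) → H¹(F, G)` in Galois cohomology, for `H` the stabilizer of `x`. Here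
`H¹(F, -)` is the cohomology of `Gal(F_s/F)` on the points over the separable closure `F_s`. -/
def stabilizerH1Map (x : ℙ F V) :
    NonabelianH1 (SeparableClosure F ≃ₐ[F] SeparableClosure F)
        (ρ.stabilizer x (SeparableClosure F)) →
      NonabelianH1 (SeparableClosure F ≃ₐ[F] SeparableClosure F)
        (GroupPoints F A (SeparableClosure F)) :=
  NonabelianH1.map (ρ.stabilizer x (SeparableClosure F)).subtype fun _ _ => rfl

end GroupRep

end

/-!
The representation is twisted. Let `K` be the separable closure of `F`, let `z` be a cocycle with
values in `G(K)`, and let `V'` be the `F`-space of vectors in `K ⊗ V` that are fixed under the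
twisted action `w ↦ z_σ · σ(w)`. By Galois descent `V'` spans `K ⊗ V`
(`GroupRep.span_twistedAction_fixedPoints`), so if `F` is infinite then some `y` in `V'` gives a
point of the open orbit (`IsZariskiOpen.exists_mk_mem`). If `g · x = [y]` with `g` in `G(K)`, then
`g⁻¹ z_σ σ(g)` fixes `x` (`GroupRep.twisted_mem_stabilizer`), so the class of `z` comes from `H`.

A priori `g` is only defined over the algebraic closure. If `F` is perfect there is no difference.
If `H` is smooth, the scheme of all `g` with `g · x = [y]` is over `K` a form of `H`: over the
algebraic closure the two differ by a translation. It is therefore smooth by descent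
(`GroupRep.smooth_transporter`), and a nonempty smooth scheme over a separably closed field has a
rational point (`Algebra.Smooth.nonempty_algHom_of_isSepClosed`).

If `F` is finite then `G` is connected, and Lang's theorem makes every cocycle trivial. The
comorphism of the Lang map `g ↦ g⁻¹ Frob(g)` is integral (`GroupPoints.isIntegral_langHom`), and
an integral endomorphism of an irreducible Noetherian scheme is surjective
(`PrimeSpectrum.comap_surjective_of_isIntegral_endomorphism`); `G` is geometrically irreducible
because it is connected and homogeneous and has a rational point
(`GroupPoints.isPrime_nilradical_baseChange`).
-/

noncomputable section

/-! ### Rational points of smooth algebras over separably closed fields -/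

/-- A finite separably closed field would be perfect, hence algebraically closed. -/
theorem IsSepClosed.infinite (k : Type*) [Field k] [IsSepClosed k] : Infinite k := by
  by_contra h
  rw [not_infinite_iff_finite] at h
  have : IsAlgClosed k := isAlgClosed_of_perfectField k
  exact not_finite k

/-- A nonempty smooth scheme over a separably closed field has a rational point: locally it is étale
over an affine space, and the fibre over a rational point of the affine space is split. -/
theorem Algebra.Smooth.nonempty_algHom_of_isSepClosed (k B : Type*) [Field k] [IsSepClosed k]
    [CommRing B] [Nontrivial B] [Algebra k B] [Algebra.Smooth k B] : Nonempty (B →ₐ[k] k) := by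
  obtain ⟨m, hm⟩ := Ideal.exists_maximal B
  have hp : m.IsPrime := hm.isPrime
  have : Algebra.IsSmoothAt k m := inferInstance
  obtain ⟨f, hf, hs⟩ := Algebra.IsSmoothAt.exists_notMem_isStandardSmooth k (S := B) m
  let S := Localization.Away f
  have hSn : Nontrivial S := by
    refine ⟨⟨0, 1, fun h => ?_⟩⟩
    rw [← map_zero (algebraMap B S), ← map_one (algebraMap B S),
      IsLocalization.eq_iff_exists (Submonoid.powers f)] at h
    obtain ⟨⟨_, n, rfl⟩, hn⟩ := h
    simp only [mul_zero, mul_one] at hn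
    exact hf (hp.mem_of_pow_mem n (hn ▸ m.zero_mem))
  suffices h : Nonempty (S →ₐ[k] k) from
    h.map fun s => s.comp (IsScalarTower.toAlgHom k B S)
  obtain ⟨n, g, hgC, hg⟩ := RingHom.IsStandardSmooth.exists_etale_mvPolynomial
    (f := algebraMap k S) (by rwa [RingHom.isStandardSmooth_algebraMap])
  algebraize [g]
  have hgC' : ∀ c : k, algebraMap (MvPolynomial (Fin n) k) S (MvPolynomial.C c) =
      algebraMap k S c := fun c => RingHom.congr_fun hgC c
  have hopen : IsOpen
      (Set.range (PrimeSpectrum.comap (algebraMap (MvPolynomial (Fin n) k) S))) := by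
    rw [← Set.image_univ]
    exact PrimeSpectrum.isOpenMap_comap_of_hasGoingDown_of_finitePresentation _ isOpen_univ
  -- The image of an étale chart is a nonempty open subset of affine space, so it has a rational
  -- point, as `k` is infinite.
  obtain ⟨a, q, hq⟩ : ∃ a : Fin n → k, ∃ q : PrimeSpectrum S, ∀ P : MvPolynomial (Fin n) k,
      MvPolynomial.eval a P = 0 → algebraMap _ S P ∈ q.asIdeal := by
    obtain ⟨q₀⟩ : Nonempty (PrimeSpectrum S) := inferInstance
    obtain ⟨_, ⟨P, rfl⟩, hqP, hsub⟩ :=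
      PrimeSpectrum.isTopologicalBasis_basic_opens.exists_subset_of_mem_open
        (Set.mem_range_self q₀) hopen
    have hP : P ≠ 0 := by
      rintro rfl
      simp at hqP
    have := IsSepClosed.infinite k
    obtain ⟨a, ha⟩ : ∃ a, MvPolynomial.eval a P ≠ 0 := by
      by_contra! h
      exact hP (MvPolynomial.funext (by simpa using h))
    obtain ⟨q, hq⟩ := hsub (show (⟨RingHom.ker (MvPolynomial.eval a), RingHom.ker_isPrime _⟩ :
      PrimeSpectrum (MvPolynomial (Fin n) k)) ∈ _ from ha)
    refine ⟨a, q, fun Q hQ => ?_⟩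
    change Q ∈ (PrimeSpectrum.comap (algebraMap (MvPolynomial (Fin n) k) S) q).asIdeal
    rw [hq]
    exact hQ
  let _ : Algebra (MvPolynomial (Fin n) k) k := (MvPolynomial.eval a).toAlgebra
  have hTn : Nontrivial (k ⊗[MvPolynomial (Fin n) k] S) := by
    let e : k →ₐ[MvPolynomial (Fin n) k] S ⧸ q.asIdeal :=
      { algebraMap k (S ⧸ q.asIdeal) with
        commutes' := fun P => by
          change algebraMap k (S ⧸ q.asIdeal) (MvPolynomial.eval a P) =
            Ideal.Quotient.mk _ (algebraMap _ S P)
          rw [IsScalarTower.algebraMap_apply k S, Ideal.Quotient.algebraMap_eq, ← hgC',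
            Ideal.Quotient.eq, ← map_sub]
          exact hq _ (by simp) }
    let h : k ⊗[MvPolynomial (Fin n) k] S →ₐ[MvPolynomial (Fin n) k] S ⧸ q.asIdeal :=
      Algebra.TensorProduct.lift e (Ideal.Quotient.mkₐ _ _) fun _ _ => .all _ _
    exact h.toRingHom.domain_nontrivial
  obtain ⟨p⟩ : Nonempty (PrimeSpectrum (k ⊗[MvPolynomial (Fin n) k] S)) := inferInstance
  let t : k ⊗[MvPolynomial (Fin n) k] S →ₐ[k] k :=
    (Pi.evalAlgHom k (fun _ => k) p).comp
      (Algebra.FormallyEtale.equivPiOfIsSepClosed k (k ⊗[MvPolynomial (Fin n) k] S)).toAlgHom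
  refine ⟨{ t.toRingHom.comp Algebra.TensorProduct.includeRight.toRingHom with
    commutes' := fun c => ?_ }⟩
  change t ((1 : k) ⊗ₜ algebraMap k S c) = c
  rw [← hgC', Algebra.algebraMap_eq_smul_one (R := MvPolynomial (Fin n) k), TensorProduct.tmul_smul,
    TensorProduct.smul_tmul', Algebra.smul_def, mul_one]
  change t ((MvPolynomial.eval a (MvPolynomial.C c)) ⊗ₜ 1) = c
  rw [MvPolynomial.eval_C]
  exact t.commutes c

/-! ### Points of `G`, translations and transporters -/

namespace GroupPoints

variable {F A R R' : Type*} [Field F] [CommRing A] [HopfAlgebra F A]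
  [CommRing R] [Algebra F R] [CommRing R'] [Algebra F R']

/-- The homomorphism `G(R) → G(R')` induced by a homomorphism of `F`-algebras `R → R'`. -/
def map (f : R →ₐ[F] R') : GroupPoints F A R →* GroupPoints F A R' where
  toFun g := WithConv.toConv (f.comp g.ofConv)
  map_one' := by
    apply WithConv.ofConv_injective
    ext a
    change f (algebraMap F R _) = algebraMap F R' _
    simp
  map_mul' g h := by
    apply WithConv.ofConv_injective
    exact AlgHom.comp_convMul_distrib f g h

@[simp]
theorem ofConv_map (f : R →ₐ[F] R') (g : GroupPoints F A R) (a : A) :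
    (map f g).ofConv a = f (g.ofConv a) := rfl

theorem ext_ofConv {g h : GroupPoints F A R} (H : ∀ a, g.ofConv a = h.ofConv a) : g = h :=
  WithConv.ofConv_injective (AlgHom.ext H)

variable (F A) (K : Type*) [Field K] [Algebra F K]

/-- The universal point of `G` over `K`-algebras, with values in the coordinate ring of `G_K`. -/
def generic : GroupPoints F A (K ⊗[F] A) :=
  WithConv.toConv Algebra.TensorProduct.includeRight

@[simp]
theorem ofConv_generic (a : A) : (generic F A K).ofConv a = 1 ⊗ₜ a := rfl

variable {F A K}

/-- The `K`-algebra homomorphism on the coordinate ring of `G_K` that corresponds to a point of `G`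
with values in a `K`-algebra. -/
def lift [Algebra K R] [IsScalarTower F K R] (g : GroupPoints F A R) : K ⊗[F] A →ₐ[K] R :=
  Algebra.TensorProduct.lift (Algebra.ofId K R) g.ofConv fun _ _ => .all _ _

@[simp]
theorem lift_tmul [Algebra K R] [IsScalarTower F K R] (g : GroupPoints F A R) (k : K) (a : A) :
    lift g (k ⊗ₜ[F] a) = algebraMap K R k * g.ofConv a := by
  simp [lift, Algebra.ofId_apply]

/-- Left translation by `h` in `G(K)`, as an endomorphism of the coordinate ring of `G_K`. -/
def translationHom (h : GroupPoints F A K) : K ⊗[F] A →ₐ[K] K ⊗[F] A :=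
  lift (map Algebra.TensorProduct.includeLeft h * generic F A K)

theorem translationHom_one_tmul (h : GroupPoints F A K) (a : A) :
    translationHom h (1 ⊗ₜ a) =
      (map Algebra.TensorProduct.includeLeft h * generic F A K).ofConv a := by
  rw [translationHom, lift_tmul, _root_.map_one, one_mul]

theorem algHom_eq_lift [Algebra K R] [IsScalarTower F K R] (s : K ⊗[F] A →ₐ[K] R) :
    s = lift (map (s.restrictScalars F) (generic F A K)) := by
  ext a
  simp

/-- The point that corresponds to `s ∘ translationHom h` is `h * g` if `g` corresponds to `s`. -/
theorem comp_translationHom [Algebra K R] [IsScalarTower F K R] (s : K ⊗[F] A →ₐ[K] R)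
    (h : GroupPoints F A K) :
    s.comp (translationHom h) =
      lift (map (IsScalarTower.toAlgHom F K R) h * map (s.restrictScalars F) (generic F A K)) := by
  have h1 : map (IsScalarTower.toAlgHom F K R) h =
      map (s.restrictScalars F) (map Algebra.TensorProduct.includeLeft h) := by
    refine ext_ofConv fun a => ?_
    simp only [ofConv_map, Algebra.TensorProduct.includeLeft_apply, AlgHom.coe_restrictScalars']
    exact (s.commutes (h.ofConv a)).symm
  rw [h1, ← _root_.map_mul]
  ext a
  change s (translationHom h (1 ⊗ₜ a)) = lift _ (1 ⊗ₜ a)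
  rw [translationHom_one_tmul, lift_tmul, _root_.map_one, one_mul]
  rfl

/-- Pulling back functions along translations reverses the order of multiplication. -/
theorem translationHom_comp (h h' : GroupPoints F A K) :
    (translationHom h).comp (translationHom h') = translationHom (h' * h) := by
  rw [comp_translationHom]
  unfold translationHom
  congr 1
  rw [_root_.map_mul, mul_assoc]
  congr 1
  refine ext_ofConv fun a => ?_
  exact translationHom_one_tmul h a

theorem translationHom_one : translationHom (1 : GroupPoints F A K) = AlgHom.id K (K ⊗[F] A) := by
  rw [translationHom, _root_.map_one, one_mul]
  ext a
  simp

/-- Left translation by `h` in `G(K)`, as an automorphism of the coordinate ring of `G_K`. -/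
def translation (h : GroupPoints F A K) : K ⊗[F] A ≃ₐ[K] K ⊗[F] A :=
  AlgEquiv.ofAlgHom (translationHom h) (translationHom h⁻¹)
    (by rw [translationHom_comp, inv_mul_cancel, translationHom_one])
    (by rw [translationHom_comp, mul_inv_cancel, translationHom_one])

theorem translation_apply (h : GroupPoints F A K) (x : K ⊗[F] A) :
    translation h x = translationHom h x := rfl

end GroupPoints

section Minors

variable {ι S S' : Type*} [CommRing S] [CommRing S']

/-- The ideal generated by the `2 × 2` minors of the matrix with rows `y` and `α`, which expresses
that `α` is proportional to `y`. -/
def minorIdeal (y α : ι → S) : Ideal S :=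
  Ideal.span (Set.range fun p : ι × ι => y p.2 * α p.1 - y p.1 * α p.2)

theorem map_minorIdeal {Φ : Type*} [FunLike Φ S S'] [RingHomClass Φ S S'] (f : Φ) (y α : ι → S) :
    (minorIdeal y α).map f = minorIdeal (fun i => f (y i)) (fun i => f (α i)) := by
  rw [minorIdeal, Ideal.map_span, ← Set.range_comp, minorIdeal]
  congr 2
  ext p
  simp

/-- A linear relation among the coordinates of a unimodular vector `y` holds for every vector
proportional to `y`. -/
theorem sum_mul_mem_minorIdeal [Fintype ι] {y α c : ι → S} {j : ι} (hj : IsUnit (y j))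
    (hc : ∑ k, c k * y k = 0) : ∑ k, c k * α k ∈ minorIdeal y α := by
  rw [← Ideal.unit_mul_mem_iff_mem _ hj]
  have : y j * ∑ k, c k * α k = ∑ k, c k * (y j * α k - y k * α j) := by
    have h : ∑ k, c k * (y k * α j) = 0 := by
      simp_rw [← mul_assoc, ← Finset.sum_mul, hc, zero_mul]
    simp_rw [mul_sub, Finset.sum_sub_distrib, h, sub_zero, Finset.mul_sum]
    exact Finset.sum_congr rfl fun k _ => by ring
  rw [this]
  exact Ideal.sum_mem _ fun k _ => Ideal.mul_mem_left _ _ (Ideal.subset_span ⟨(k, j), rfl⟩)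

/-- If `M y = c y'`, then `M` takes the vectors proportional to `y` to vectors proportional to
`y'`. -/
theorem minorIdeal_mulVec_le [Fintype ι] {y y' α : ι → S} {M : ι → ι → S} {c : S} {j : ι}
    (hj : IsUnit (y j)) (hM : ∀ i, ∑ k, M i k * y k = c * y' i) :
    minorIdeal y' (fun i => ∑ k, M i k * α k) ≤ minorIdeal y α := by
  refine Ideal.span_le.mpr ?_
  rintro _ ⟨⟨i, l⟩, rfl⟩
  have h : ∀ β : ι → S, ∑ k, (y' l * M i k - y' i * M l k) * β k =
      y' l * ∑ k, M i k * β k - y' i * ∑ k, M l k * β k := by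
    intro β
    simp_rw [sub_mul, Finset.sum_sub_distrib, Finset.mul_sum, mul_assoc]
  have := sum_mul_mem_minorIdeal (α := α) (c := fun k => y' l * M i k - y' i * M l k) hj
    (by rw [h, hM, hM]; ring)
  rwa [h] at this

end Minors

namespace GroupRep

variable {F A V ι : Type*} [Field F] [CommRing A] [HopfAlgebra F A]
  [AddCommGroup V] [Module F V] (ρ : GroupRep F A V) (b : Module.Basis ι F V)

/-- The regular function `g ↦ i`-th coordinate of `g · v` on `G`. -/
def coeff (i : ι) : V →ₗ[F] A :=
  (TensorProduct.lid F A).toLinearMap ∘ₗ (b.coord i).rTensor A ∘ₗ ρ.coact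

variable {R : Type*} [CommRing R] [Algebra F R]

theorem repr_actOn (g : GroupPoints F A R) (v : V) (i : ι) :
    (b.baseChange R).repr (ρ.actOn g v) i = g.ofConv (ρ.coeff b i v) := by
  change (b.baseChange R).repr (TensorProduct.comm F V R
    (g.ofConv.toLinearMap.lTensor V (ρ.coact v))) i =
    g.ofConv (TensorProduct.lid F A ((b.coord i).rTensor A (ρ.coact v)))
  generalize ρ.coact v = t
  induction t with
  | zero => simp
  | add s t hs ht => simp only [map_add, Finsupp.add_apply, hs, ht]
  | tmul w a => simp

variable [Fintype ι]

theorem actOn_eq_sum (g : GroupPoints F A R) (v : V) :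
    ρ.actOn g v = ∑ k, g.ofConv (ρ.coeff b k v) • ((1 : R) ⊗ₜ[F] b k) := by
  conv_lhs => rw [← (b.baseChange R).sum_repr (ρ.actOn g v)]
  exact Finset.sum_congr rfl fun k _ => by rw [repr_actOn, Module.Basis.baseChange_apply]

/-- The matrix coefficients are multiplicative. -/
theorem ofConv_mul_coeff (g h : GroupPoints F A R) (v : V) (i : ι) :
    (g * h).ofConv (ρ.coeff b i v) =
      ∑ k, g.ofConv (ρ.coeff b i (b k)) * h.ofConv (ρ.coeff b k v) := by
  rw [← repr_actOn, ← one_smul R (ρ.actOn (g * h) v), ← act_tmul, act_mul, Module.End.mul_apply,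
    act_tmul, one_smul, ρ.actOn_eq_sum b h v, map_sum, map_sum, Finsupp.finsetSum_apply]
  refine Finset.sum_congr rfl fun k _ => ?_
  rw [map_smul, act_tmul, one_smul, map_smul, Finsupp.smul_apply, repr_actOn, smul_eq_mul, mul_comm]

omit [Fintype ι] in
theorem ofConv_one_coeff (v : V) (i : ι) :
    (1 : GroupPoints F A R).ofConv (ρ.coeff b i v) = algebraMap F R (b.repr v i) := by
  rw [← repr_actOn, ← one_smul R (ρ.actOn 1 v), ← act_tmul, act_one, Module.End.one_apply]
  simp [Algebra.smul_def]

theorem ofConv_coeff_eq_sum (g : GroupPoints F A R) (v : V) (i : ι) :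
    g.ofConv (ρ.coeff b i v) = ∑ k, g.ofConv (ρ.coeff b i (b k)) * algebraMap F R (b.repr v k) := by
  have := ρ.ofConv_mul_coeff b g 1 v i
  simpa only [mul_one, ofConv_one_coeff] using this

/-- The functional `b.repr v l • b.coord i - b.repr v i • b.coord l` gives the `(i, l)` minor, and
these functionals span those that vanish at `v`. -/
theorem stabilizerIdeal_eq_minorIdeal {v : V} (hv : v ≠ 0) :
    ρ.stabilizerIdeal (Projectivization.mk F v hv) =
      minorIdeal (fun i => algebraMap F A (b.repr v i)) fun i => ρ.coeff b i v := by
  obtain ⟨j, hj⟩ : ∃ j, b.repr v j ≠ 0 := by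
    by_contra! h
    exact hv (b.ext_elem (by simpa using h))
  apply le_antisymm <;> refine Ideal.span_le.mpr ?_
  · rintro _ ⟨w, hw, φ, hφ, rfl⟩
    rw [Projectivization.submodule_mk] at hw hφ
    obtain ⟨c, rfl⟩ := Submodule.mem_span_singleton.mp hw
    have hφv : φ v = 0 :=
      (Submodule.mem_dualAnnihilator φ).mp hφ v (Submodule.mem_span_singleton_self v)
    have h1 : ∀ t : V ⊗[F] A, TensorProduct.lid F A (φ.rTensor A t) =
        ∑ k, algebraMap F A (φ (b k)) * TensorProduct.lid F A ((b.coord k).rTensor A t) := by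
      intro t
      induction t with
      | zero => simp
      | add s t hs ht => simp only [map_add, hs, ht, mul_add, Finset.sum_add_distrib]
      | tmul w a =>
        conv_lhs => rw [← b.sum_repr w]
        simp only [LinearMap.rTensor_tmul, map_sum, map_smul, TensorProduct.lid_tmul,
          Module.Basis.coord_apply, Algebra.smul_def, _root_.map_mul, Finset.sum_mul,
          Algebra.algebraMap_self, RingHom.id_apply]
        exact Finset.sum_congr rfl fun k _ => by ring
    rw [map_smul, map_smul, map_smul, h1, Algebra.smul_def]
    refine Ideal.mul_mem_left _ _ (sum_mul_mem_minorIdeal (j := j)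
      ((IsUnit.mk0 _ hj).map (algebraMap F A)) ?_)
    simp_rw [← _root_.map_mul, ← map_sum]
    rw [← b.sum_repr v] at hφv
    simp only [map_sum, map_smul, smul_eq_mul] at hφv
    simp_rw [mul_comm (φ _), hφv, map_zero]
  · rintro _ ⟨⟨i, l⟩, rfl⟩
    refine Ideal.subset_span ⟨v, ?_, b.repr v l • b.coord i - b.repr v i • b.coord l, ?_, ?_⟩
    · rw [Projectivization.submodule_mk]
      exact Submodule.mem_span_singleton_self v
    · rw [Projectivization.submodule_mk, Submodule.mem_dualAnnihilator]
      intro w hw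
      obtain ⟨c, rfl⟩ := Submodule.mem_span_singleton.mp hw
      simp only [map_smul, LinearMap.sub_apply, LinearMap.smul_apply, Module.Basis.coord_apply,
        smul_eq_mul]
      ring
    · rw [LinearMap.rTensor_sub, LinearMap.rTensor_smul, LinearMap.rTensor_smul,
        LinearMap.sub_apply, map_sub]
      simp [coeff, Algebra.smul_def]

section Transporter

variable {K L : Type*} [Field K] [Algebra F K] [Field L] [Algebra F L] [Algebra K L]
  [IsScalarTower F K L]

variable (K) in
/-- The ideal of the coordinate ring of `G_K` that defines the scheme of the `g` which send `v` to a
multiple of the vector with coordinates `y`. -/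
def transporterIdeal (v : V) (y : ι → K) : Ideal (K ⊗[F] A) :=
  minorIdeal (fun i => y i ⊗ₜ[F] (1 : A)) fun i => (1 : K) ⊗ₜ[F] ρ.coeff b i v

/-- Translation by a rational point of a transporter identifies it with the stabilizer. -/
theorem map_translation_transporterIdeal {v : V} (hv : v ≠ 0) {y : ι → L} {c : L}
    (g : GroupPoints F A L) (hg : ∀ i, g.ofConv (ρ.coeff b i v) = c * y i) :
    (ρ.transporterIdeal b L v y).map (GroupPoints.translation g) =
      (ρ.stabilizerIdeal (Projectivization.mk F v hv)).map
        (Algebra.TensorProduct.includeRight : A →ₐ[F] L ⊗[F] A) := by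
  obtain ⟨j, hj⟩ : ∃ j, b.repr v j ≠ 0 := by
    by_contra! h
    exact hv (b.ext_elem (by simpa using h))
  -- `g⁻¹` takes `c • y` back to `v ≠ 0`, so neither `c` nor `y` vanishes.
  have hinv : ∀ i, ∑ k, g⁻¹.ofConv (ρ.coeff b i (b k)) * (c * y k) =
      algebraMap F L (b.repr v i) := by
    intro i
    rw [← ofConv_one_coeff (R := L) ρ b v i, ← inv_mul_cancel g, ofConv_mul_coeff]
    simp_rw [hg]
  have hc : c ≠ 0 := by
    rintro rfl
    have := hinv j
    simp only [zero_mul, mul_zero, Finset.sum_const_zero] at this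
    exact hj ((map_eq_zero (algebraMap F L)).mp this.symm)
  obtain ⟨l, hl⟩ : ∃ l, y l ≠ 0 := by
    by_contra! h
    have := hinv j
    simp only [h, mul_zero, Finset.sum_const_zero] at this
    exact hj ((map_eq_zero (algebraMap F L)).mp this.symm)
  have hunit : ∀ x : L, x ≠ 0 → IsUnit (x ⊗ₜ[F] (1 : A)) := fun x hx =>
    (IsUnit.mk0 x hx).map (Algebra.TensorProduct.includeLeft : L →ₐ[F] L ⊗[F] A)
  have htrans : ∀ (h : GroupPoints F A L) (i : ι),
      GroupPoints.translation h ((1 : L) ⊗ₜ[F] ρ.coeff b i v) =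
        ∑ k, (h.ofConv (ρ.coeff b i (b k)) ⊗ₜ[F] (1 : A)) * ((1 : L) ⊗ₜ[F] ρ.coeff b k v) := by
    intro h i
    rw [GroupPoints.translation_apply, GroupPoints.translationHom_one_tmul, ofConv_mul_coeff]
    rfl
  have hscal : ∀ (h : GroupPoints F A L) (x : L),
      GroupPoints.translation h (x ⊗ₜ[F] (1 : A)) = x ⊗ₜ[F] (1 : A) := fun h x =>
    (GroupPoints.translation h).commutes x
  have hI : (ρ.stabilizerIdeal (Projectivization.mk F v hv)).map
      (Algebra.TensorProduct.includeRight : A →ₐ[F] L ⊗[F] A) =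
      minorIdeal (fun i => algebraMap F L (b.repr v i) ⊗ₜ[F] (1 : A))
        fun i => (1 : L) ⊗ₜ[F] ρ.coeff b i v := by
    rw [stabilizerIdeal_eq_minorIdeal ρ b hv, map_minorIdeal]
    congr 1
    ext i
    rw [Algebra.TensorProduct.includeRight_apply, Algebra.algebraMap_eq_smul_one,
      Algebra.algebraMap_eq_smul_one, TensorProduct.tmul_smul, TensorProduct.smul_tmul']
  rw [hI]
  apply le_antisymm
  · rw [transporterIdeal, map_minorIdeal]
    simp_rw [htrans, hscal]
    refine minorIdeal_mulVec_le (c := c ⊗ₜ 1) (hunit _ (by simpa using hj)) fun i => ?_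
    simp only [Algebra.TensorProduct.tmul_mul_tmul, mul_one, ← TensorProduct.sum_tmul]
    rw [← ofConv_coeff_eq_sum, hg]
  · have hle : (minorIdeal (fun i => algebraMap F L (b.repr v i) ⊗ₜ[F] (1 : A))
        fun i => (1 : L) ⊗ₜ[F] ρ.coeff b i v).map (GroupPoints.translation g⁻¹) ≤
          ρ.transporterIdeal b L v y := by
      rw [transporterIdeal, map_minorIdeal]
      simp_rw [htrans, hscal]
      refine minorIdeal_mulVec_le (c := c⁻¹ ⊗ₜ 1) (hunit _ hl) fun i => ?_
      simp only [Algebra.TensorProduct.tmul_mul_tmul, mul_one, ← TensorProduct.sum_tmul]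
      congr 1
      rw [← hinv i, Finset.mul_sum]
      refine Finset.sum_congr rfl fun k _ => ?_
      field_simp
    intro a ha
    have hinv' : a = GroupPoints.translation g (GroupPoints.translation g⁻¹ a) := by
      change a = ((GroupPoints.translationHom g).comp (GroupPoints.translationHom g⁻¹)) a
      rw [GroupPoints.translationHom_comp, inv_mul_cancel, GroupPoints.translationHom_one]
      rfl
    rw [hinv']
    exact Ideal.mem_map_of_mem _ (hle (Ideal.mem_map_of_mem _ ha))

/-- The transporter is a form of the stabilizer `H`, hence smooth if `H` is, by faithfully flat
descent. -/
theorem smooth_transporter {v : V} (hv : v ≠ 0)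
    [Algebra.Smooth F (A ⧸ ρ.stabilizerIdeal (Projectivization.mk F v hv))] {y : ι → K} {c : L}
    (g : GroupPoints F A L) (hg : ∀ i, g.ofConv (ρ.coeff b i v) = c * algebraMap K L (y i)) :
    Algebra.Smooth K ((K ⊗[F] A) ⧸ ρ.transporterIdeal b K v y) := by
  have hmap := map_translation_transporterIdeal ρ b hv g hg
  let e₁ := Algebra.TensorProduct.tensorQuotientEquiv (R := F) L A L
    (ρ.stabilizerIdeal (Projectivization.mk F v hv))
  let e₂ := Ideal.quotientEquivAlg _ _ (GroupPoints.translation g) hmap.symm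
  let C := Algebra.TensorProduct.cancelBaseChange F K L L A
  have hC : ρ.transporterIdeal b L v (fun i => algebraMap K L (y i)) =
      ((ρ.transporterIdeal b K v y).map
        (Algebra.TensorProduct.includeRight : (K ⊗[F] A) →ₐ[K] L ⊗[K] (K ⊗[F] A))).map C := by
    rw [transporterIdeal, transporterIdeal, map_minorIdeal, map_minorIdeal]
    congr 1 <;> ext i
    · simp [C, Algebra.smul_def]
    · simp [C]
  let e₃ := Ideal.quotientEquivAlg _ _ C hC
  let e₄ := Algebra.TensorProduct.tensorQuotientEquiv (R := K) L (K ⊗[F] A) L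
    (ρ.transporterIdeal b K v y)
  let e := e₁.trans (e₂.symm.trans (e₃.symm.trans e₄.symm))
  have : Algebra.Smooth L (L ⊗[K] ((K ⊗[F] A) ⧸ ρ.transporterIdeal b K v y)) :=
    Algebra.Smooth.of_equiv e
  exact Algebra.Smooth.of_smooth_tensorProduct_of_faithfullyFlat L

/-- If the stabilizer of a rational point is smooth, then a point over a separably closed field `K`
that is conjugate to it over an extension of `K` is conjugate to it over `K`. -/
theorem exists_point_transporter [IsSepClosed K] {v : V} (hv : v ≠ 0)
    [Algebra.Smooth F (A ⧸ ρ.stabilizerIdeal (Projectivization.mk F v hv))] {y : ι → K}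
    (hy : ∃ l, y l ≠ 0) {c : L}
    (g : GroupPoints F A L) (hg : ∀ i, g.ofConv (ρ.coeff b i v) = c * algebraMap K L (y i)) :
    ∃ (h : GroupPoints F A K) (d : K), ∀ i, h.ofConv (ρ.coeff b i v) = d * y i := by
  have := smooth_transporter ρ b hv g hg
  have : Nontrivial ((K ⊗[F] A) ⧸ ρ.transporterIdeal b K v y) := by
    rw [Ideal.Quotient.nontrivial_iff]
    intro htop
    have hle : ρ.transporterIdeal b K v y ≤
        RingHom.ker (GroupPoints.lift g : K ⊗[F] A →ₐ[K] L) := by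
      refine Ideal.span_le.mpr ?_
      rintro _ ⟨⟨i, l⟩, rfl⟩
      simp only [SetLike.mem_coe, RingHom.mem_ker, Algebra.TensorProduct.tmul_mul_tmul, map_sub,
        GroupPoints.lift_tmul, one_mul, mul_one, hg]
      ring
    rw [htop, top_le_iff] at hle
    exact RingHom.ker_ne_top _ hle
  obtain ⟨s⟩ := Algebra.Smooth.nonempty_algHom_of_isSepClosed K
    ((K ⊗[F] A) ⧸ ρ.transporterIdeal b K v y)
  let s' : K ⊗[F] A →ₐ[K] K := s.comp (Ideal.Quotient.mkₐ K _)
  obtain ⟨l, hl⟩ := hy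
  refine ⟨GroupPoints.map (s'.restrictScalars F) (GroupPoints.generic F A K),
    s' (1 ⊗ₜ ρ.coeff b l v) / y l, fun i => ?_⟩
  have h0 : s' (y l ⊗ₜ[F] (1 : A) * (1 : K) ⊗ₜ[F] ρ.coeff b i v -
      y i ⊗ₜ[F] (1 : A) * (1 : K) ⊗ₜ[F] ρ.coeff b l v) = 0 := by
    change s (Ideal.Quotient.mk _ _) = 0
    rw [Ideal.Quotient.eq_zero_iff_mem.mpr, map_zero]
    exact Ideal.subset_span ⟨(i, l), rfl⟩
  have hsc : ∀ x : K, s' (x ⊗ₜ[F] (1 : A)) = x := fun x => s'.commutes x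
  rw [map_sub, _root_.map_mul, _root_.map_mul, hsc, hsc, sub_eq_zero] at h0
  simp only [GroupPoints.ofConv_map, GroupPoints.ofConv_generic, AlgHom.coe_restrictScalars']
  rw [div_mul_eq_mul_div, eq_div_iff hl, mul_comm, h0, mul_comm]

end Transporter

end GroupRep

/-! ### Galois descent and points of open sets -/

open scoped Topology in
theorem AlgEquiv.setOf_apply_eq_mem_nhds_one {F K : Type*} [Field F] [Field K] [Algebra F K]
    [Algebra.IsAlgebraic F K] (k : K) :
    {σ : K ≃ₐ[F] K | σ k = k} ∈ 𝓝 1 := by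
  rw [krullTopology_mem_nhds_one_iff]
  refine ⟨IntermediateField.adjoin F {k},
    IntermediateField.adjoin.finiteDimensional (Algebra.IsIntegral.isIntegral k), fun σ hσ => ?_⟩
  exact (IntermediateField.mem_fixingSubgroup_iff _ σ).mp hσ k
    (IntermediateField.mem_adjoin_simple_self F k)

open scoped Topology in
/-- Galois descent for vector spaces: a continuous semilinear action of the Galois group has enough
fixed vectors. A linear form `φ` that kills them is zero: for `w` fixed by the automorphisms over a
finite extension `L` of `F`, it kills the traces `∑ τ(c) • τ(w)`, and the embeddings `τ` of `L` are
linearly independent. -/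
theorem span_fixedPoints_eq_top {F K W : Type*} [Field F] [Field K] [Algebra F K] [Normal F K]
    [AddCommGroup W] [Module F W] [Module K W] (s : (K ≃ₐ[F] K) →* Module.End F W)
    (hs : ∀ (σ : K ≃ₐ[F] K) (c : K) (w : W), s σ (c • w) = σ c • s σ w)
    (hcont : ∀ w, {σ | s σ w = w} ∈ 𝓝 (1 : K ≃ₐ[F] K)) :
    Submodule.span K {w | ∀ σ, s σ w = w} = ⊤ := by
  by_contra hne
  obtain ⟨φ, hφ0, hφ⟩ := Submodule.exists_le_ker_of_lt_top _ (lt_top_iff_ne_top.mpr hne)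
  refine hφ0 (LinearMap.ext fun w => ?_)
  obtain ⟨L, hL, hLs⟩ := (krullTopology_mem_nhds_one_iff F K _).mp (hcont w)
  -- `ext τ` extends an embedding of `L` to an automorphism of `K`.
  let ext : (L →ₐ[F] K) → (K ≃ₐ[F] K) := fun τ =>
    AlgEquiv.ofBijective (τ.liftNormal K) (Algebra.IsAlgebraic.algHom_bijective _)
  have hext : ∀ τ (c : L), ext τ c = τ c := fun τ c => τ.liftNormal_commutes K c
  have hagree : ∀ σ τ : K ≃ₐ[F] K, (∀ c : L, σ c = τ c) → s σ w = s τ w := by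
    intro σ τ h
    have h1 : τ⁻¹ * σ ∈ L.fixingSubgroup := by
      rw [IntermediateField.mem_fixingSubgroup_iff]
      intro c hc
      change τ.symm (σ c) = c
      rw [h ⟨c, hc⟩, AlgEquiv.symm_apply_apply]
    have h2 : s (τ⁻¹ * σ) w = w := hLs h1
    calc s σ w = s (τ * (τ⁻¹ * σ)) w := by rw [mul_inv_cancel_left]
      _ = s τ w := by rw [map_mul, Module.End.mul_apply, h2]
  let T : L → W := fun c => ∑ τ : L →ₐ[F] K, τ c • s (ext τ) w
  have hT : ∀ c σ, s σ (T c) = T c := by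
    intro c σ
    simp only [T, map_sum, hs]
    refine Fintype.sum_equiv (AlgEquiv.arrowCongr AlgEquiv.refl σ) _ _ fun τ => ?_
    rw [← Module.End.mul_apply, ← map_mul]
    congr 1
    refine hagree _ _ fun d => ?_
    rw [hext]
    change σ (ext τ d) = σ (τ d)
    rw [hext]
  have hli := linearIndependent_toLinearMap F L K
  rw [Fintype.linearIndependent_iff] at hli
  have h0 := hli (fun τ => φ (s (ext τ) w)) (by
    ext c
    have h := hφ (Submodule.subset_span (hT c))
    rw [LinearMap.mem_ker] at h
    simpa [T, mul_comm] using h) L.val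
  rw [hagree (ext L.val) 1 fun c => hext _ c, map_one] at h0
  simpa using h0

namespace GroupRep

variable {F A V : Type*} [Field F] [CommRing A] [HopfAlgebra F A]
  [AddCommGroup V] [Module F V] (ρ : GroupRep F A V) {K : Type*} [Field K] [Algebra F K]

theorem rTensor_act (σ : K ≃ₐ[F] K) (g : GroupPoints F A K) (w : K ⊗[F] V) :
    (σ : K →ₐ[F] K).toLinearMap.rTensor V (ρ.act g w) =
      ρ.act (σ • g) ((σ : K →ₐ[F] K).toLinearMap.rTensor V w) := by
  induction w with
  | zero => simp
  | add s t hs ht => simp only [map_add, hs, ht]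
  | tmul k v =>
    rw [act_tmul, LinearMap.rTensor_tmul, act_tmul, actOn_smul]
    generalize ρ.actOn g v = t
    induction t with
    | zero => simp
    | add s t hs ht => simp only [map_add, smul_add, hs, ht]
    | tmul l u => simp [TensorProduct.smul_tmul']

theorem rTensor_smul (σ : K ≃ₐ[F] K) (c : K) (w : K ⊗[F] V) :
    (σ : K →ₐ[F] K).toLinearMap.rTensor V (c • w) =
      σ c • (σ : K →ₐ[F] K).toLinearMap.rTensor V w := by
  induction w with
  | zero => simp
  | add s t hs ht => simp only [map_add, smul_add, hs, ht]
  | tmul k v => simp [TensorProduct.smul_tmul']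

/-- The semilinear action of the Galois group on `K ⊗ V` twisted by a cocycle `z`, for which `σ`
acts by `w ↦ z_σ · σ(w)`. -/
def twistedAction (z : OneCocycle (K ≃ₐ[F] K) (GroupPoints F A K)) :
    (K ≃ₐ[F] K) →* Module.End F (K ⊗[F] V) where
  toFun σ := (ρ.act (z.toFun σ)).restrictScalars F ∘ₗ (σ : K →ₐ[F] K).toLinearMap.rTensor V
  map_one' := by
    have h1 : z.toFun 1 = 1 := by simpa using z.map_mul 1 1
    ext k v
    simp [h1, act_one]
  map_mul' σ τ := by
    refine LinearMap.ext fun w => ?_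
    rw [Module.End.mul_apply]
    simp only [LinearMap.comp_apply, LinearMap.restrictScalars_apply]
    rw [rTensor_act, z.map_mul, act_mul, Module.End.mul_apply]
    congr 2
    rw [← LinearMap.rTensor_comp_apply]
    rfl

theorem twistedAction_apply (z : OneCocycle (K ≃ₐ[F] K) (GroupPoints F A K)) (σ : K ≃ₐ[F] K)
    (w : K ⊗[F] V) : ρ.twistedAction z σ w =
      ρ.act (z.toFun σ) ((σ : K →ₐ[F] K).toLinearMap.rTensor V w) := rfl

theorem span_twistedAction_fixedPoints [Normal F K]
    (z : OneCocycle (K ≃ₐ[F] K) (GroupPoints F A K)) :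
    Submodule.span K {w | ∀ σ, ρ.twistedAction z σ w = w} = ⊤ := by
  refine span_fixedPoints_eq_top _ (fun σ c w => ?_) fun w => ?_
  · rw [twistedAction_apply, rTensor_smul, map_smul, twistedAction_apply]
  · have h1 : z.toFun 1 = 1 := by simpa using z.map_mul 1 1
    induction w with
    | zero => simp
    | add s t hs ht =>
      filter_upwards [hs, ht] with σ h h'
      rw [map_add, h, h']
    | tmul k v =>
      filter_upwards [AlgEquiv.setOf_apply_eq_mem_nhds_one k,
        (z.isLocallyConstant.eventually_eq 1)] with σ h h'
      rw [twistedAction_apply, h', h1, act_one, Module.End.one_apply]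
      change σ k ⊗ₜ[F] v = _
      rw [h]

end GroupRep

/-- Over an infinite field `F`, an `F`-structure on a vector space over an extension meets every
nonempty open subset of the projective space. -/
theorem IsZariskiOpen.exists_mk_mem {F L W : Type*} [Field F] [Infinite F] [Field L] [Algebra F L]
    [AddCommGroup W] [Module L W] [Module F W] [IsScalarTower F L W] [FiniteDimensional L W]
    {U : Set (ℙ L W)} (hU : IsZariskiOpen U) (hne : U.Nonempty) (D : Submodule F W)
    (hD : Submodule.span L (D : Set W) = ⊤) :
    ∃ y ∈ D, ∃ hy : y ≠ 0, Projectivization.mk L y hy ∈ U := by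
  obtain ⟨I, -, hI⟩ := hU
  obtain ⟨p, hp⟩ := hne
  obtain ⟨f, hf, w, hw⟩ : ∃ f ∈ I, ∃ w : W, MvPolynomial.eval (fun φ => φ w) f ≠ 0 := by
    have h : p ∉ Uᶜ := fun h => h hp
    rw [hI] at h
    simp only [Set.mem_ofPred_eq, not_forall] at h
    obtain ⟨f, hf, w, -, hw⟩ := h
    exact ⟨f, hf, w, hw⟩
  obtain ⟨B, hBD, hB⟩ := Submodule.fg_span_iff_fg_span_finset_subset (R := L) (D : Set W) |>.mp
    (IsNoetherian.noetherian _)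
  rw [hD] at hB
  have hrep : ∀ u : W, ∃ c : B → L, ∑ i, c i • (i : W) = u := by
    intro u
    have hu : u ∈ Submodule.span L (B : Set W) := hB ▸ Submodule.mem_top
    obtain ⟨c, hc⟩ := Submodule.mem_span_finset'.mp hu
    exact ⟨c, hc⟩
  let P : Module.Dual L W → MvPolynomial B L := fun φ =>
    ∑ i : B, MvPolynomial.C (φ i) * MvPolynomial.X i
  have hP : ∀ φ c, MvPolynomial.eval c (P φ) = φ (∑ i : B, c i • (i : W)) := by
    intro φ c
    simp [P, mul_comm]
  obtain ⟨ψ, u, hψ⟩ : ∃ (ψ : Module.Dual L W) (u : W), ψ u ≠ 0 := by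
    obtain ⟨ψ, hψ⟩ := Module.Projective.exists_dual_ne_zero L p.rep_nonzero
    exact ⟨ψ, _, hψ⟩
  -- `Q` is the function `f` in terms of coordinates with respect to the spanning family `B ⊆ D`.
  let Q : MvPolynomial B L := MvPolynomial.bind₁ P f
  have hQ : ∀ c, MvPolynomial.eval c Q =
      MvPolynomial.eval (fun φ => φ (∑ i : B, c i • (i : W))) f := by
    intro c
    simp_rw [← hP]
    exact MvPolynomial.eval₂Hom_bind₁ _ _ _ _
  have hQ0 : Q ≠ 0 := by
    intro h
    obtain ⟨c, hc⟩ := hrep w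
    have := hQ c
    rw [h, hc, map_zero] at this
    exact hw this.symm
  have hP0 : P ψ ≠ 0 := by
    intro h
    obtain ⟨c, hc⟩ := hrep u
    have := hP ψ c
    rw [h, hc, map_zero] at this
    exact hψ this.symm
  -- The factor `P ψ` keeps the vector found below away from zero.
  obtain ⟨c, hc⟩ : ∃ c : B → F,
      MvPolynomial.eval (fun i => algebraMap F L (c i)) (Q * P ψ) ≠ 0 := by
    by_contra! h
    refine mul_ne_zero hQ0 hP0 (MvPolynomial.funext_set (fun _ => Set.range (algebraMap F L))
      (fun _ => Set.infinite_range_of_injective (algebraMap F L).injective) fun a ha => ?_)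
    choose c hc using fun i => ha i (Set.mem_univ i)
    obtain rfl : (fun i => algebraMap F L (c i)) = a := funext hc
    rw [h, map_zero]
  rw [map_mul, hQ, hP] at hc
  have hy0 := right_ne_zero_of_mul hc
  have hy1 := left_ne_zero_of_mul hc
  refine ⟨∑ i : B, algebraMap F L (c i) • (i : W), Submodule.sum_mem _ fun i _ => ?_,
    fun h => ?_, ?_⟩
  · rw [algebraMap_smul]
    exact D.smul_mem _ (hBD i.2)
  · rw [h, map_zero] at hy0
    exact hy0 rfl
  · by_contra hU
    have : Projectivization.mk L _ _ ∈ Uᶜ := hU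
    rw [hI] at this
    refine hy1 (this f hf _ ?_)
    rw [Projectivization.submodule_mk]
    exact Submodule.mem_span_singleton_self _

/-! ### Integral endomorphisms and irreducibility -/

section CommutativeAlgebra

/-- If the `q`-th power of each `x k` is a linear combination of the `x j`, with `2 ≤ q`, then the
monomials in the `x k` of degree at most `|ι| * (q - 1)` span the algebra that the `x k` generate: a
monomial of larger degree is divisible by some `x k ^ q`. -/
theorem isIntegral_of_pow_eq_sum {R S ι : Type*} [CommRing R] [CommRing S] [Algebra R S] [Fintype ι]
    {q : ℕ} (hq : 2 ≤ q) (x : ι → S) (r : ι → ι → R) (h : ∀ k, x k ^ q = ∑ j, r k j • x j) (k : ι) :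
    IsIntegral R (x k) := by
  classical
  let D := Fintype.card ι * (q - 1)
  let E : Set (ι → ℕ) := {e | ∑ i, e i ≤ D}
  let m : (ι → ℕ) → S := fun e => ∏ i, x i ^ e i
  let N : Submodule R S := Submodule.span R (m '' E)
  have hm : ∀ e e', m (e + e') = m e * m e' := fun e e' => by
    simp only [m, Pi.add_apply, pow_add, Finset.prod_mul_distrib]
  have hms : ∀ k n, m (Pi.single k n) = x k ^ n := fun k n => by
    simp only [m]
    rw [Finset.prod_eq_single k (fun j _ hj => by rw [Pi.single_eq_of_ne hj, pow_zero])
      (by simp), Pi.single_eq_same]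
  have hsum : ∀ k n, ∑ i, (Pi.single k n : ι → ℕ) i = n := fun k n => by
    rw [Finset.sum_eq_single k (fun j _ hj => Pi.single_eq_of_ne hj _) (by simp), Pi.single_eq_same]
  have hE : E.Finite := by
    refine Set.Finite.subset (Set.Finite.pi' fun _ => Set.finite_Iic D) fun e he i => ?_
    exact (Finset.single_le_sum (fun _ _ => Nat.zero_le _) (Finset.mem_univ i)).trans he
  have hN : N.FG := Submodule.fg_span (hE.image m)
  have hmul : ∀ k, ∀ s ∈ N, x k * s ∈ N := by
    intro k s hs
    induction hs using Submodule.span_induction with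
    | zero => simp
    | add s t _ _ hs ht => rw [mul_add]; exact N.add_mem hs ht
    | smul a s _ hs => rw [mul_smul_comm]; exact N.smul_mem a hs
    | mem s hs =>
      obtain ⟨e, he, rfl⟩ := hs
      rw [← pow_one (x k), ← hms, ← hm]
      by_cases hD : (Pi.single k 1 + e : ι → ℕ) ∈ E
      · exact Submodule.subset_span (Set.mem_image_of_mem m hD)
      have hdeg : ∑ i, (Pi.single k 1 + e : ι → ℕ) i = D + 1 := by
        have h1 : ∑ i, (Pi.single k 1 + e : ι → ℕ) i = 1 + ∑ i, e i := by
          simp only [Pi.add_apply, Finset.sum_add_distrib, hsum]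
        have h2 : ¬ ∑ i, (Pi.single k 1 + e : ι → ℕ) i ≤ D := hD
        have h3 : ∑ i, e i ≤ D := he
        omega
      generalize (Pi.single k 1 + e : ι → ℕ) = e' at hdeg ⊢
      obtain ⟨j, hj⟩ : ∃ j, q ≤ e' j := by
        by_contra! hlt
        have : ∑ i, e' i ≤ ∑ _i : ι, (q - 1) :=
          Finset.sum_le_sum fun i _ => Nat.le_sub_one_of_lt (hlt i)
        rw [Finset.sum_const, Finset.card_univ, smul_eq_mul] at this
        omega
      obtain ⟨e'', rfl⟩ : ∃ e'' : ι → ℕ, e' = Pi.single j q + e'' := by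
        refine ⟨e' - Pi.single j q, ?_⟩
        rw [add_tsub_cancel_of_le]
        intro i
        by_cases hi : i = j
        · subst hi; simpa using hj
        · simp [hi]
      rw [hm, hms, h, Finset.sum_mul]
      refine N.sum_mem fun l _ => ?_
      rw [smul_mul_assoc, ← pow_one (x l), ← hms, ← hm]
      refine N.smul_mem _ (Submodule.subset_span (Set.mem_image_of_mem m ?_))
      simp only [Pi.add_apply, Finset.sum_add_distrib, hsum] at hdeg
      change ∑ i, (Pi.single l 1 + e'' : ι → ℕ) i ≤ D
      simp only [Pi.add_apply, Finset.sum_add_distrib, hsum]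
      omega
  have hadj : Subalgebra.toSubmodule (Algebra.adjoin R (Set.range x)) = N := by
    apply le_antisymm
    · let T : Subalgebra R S :=
        { carrier := {s | ∀ t ∈ N, s * t ∈ N}
          mul_mem' := fun {a b} ha hb t ht => by rw [mul_assoc]; exact ha _ (hb _ ht)
          add_mem' := fun {a b} ha hb t ht => by rw [add_mul]; exact N.add_mem (ha _ ht) (hb _ ht)
          algebraMap_mem' := fun a t ht => by rw [← Algebra.smul_def]; exact N.smul_mem _ ht }
      have hT : Algebra.adjoin R (Set.range x) ≤ T := by
        rw [Algebra.adjoin_le_iff]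
        rintro _ ⟨k, rfl⟩
        exact hmul k
      intro s hs
      have h1 : (1 : S) ∈ N := by
        simpa [m] using! Submodule.subset_span (R := R)
          (Set.mem_image_of_mem m (show 0 ∈ E by simp [E]))
      simpa using hT hs 1 h1
    · refine Submodule.span_le.mpr ?_
      rintro _ ⟨e, -, rfl⟩
      exact Subalgebra.prod_mem _ fun i _ =>
        Subalgebra.pow_mem _ (Algebra.subset_adjoin (Set.mem_range_self i)) _
  exact IsIntegral.of_mem_of_fg _ (hadj ▸ hN) _ (Algebra.subset_adjoin (Set.mem_range_self k))

theorem PrimeSpectrum.strictMono_comap_of_isIntegral {R S : Type*} [CommRing R] [CommRing S]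
    (f : R →+* S) (hf : f.IsIntegral) : StrictMono (PrimeSpectrum.comap f) := by
  intro p p' hp
  algebraize [f]
  exact Ideal.IsIntegral.comap_lt_comap (R := R) (I := p.asIdeal) (J := p'.asIdeal) hp

theorem PrimeSpectrum.exists_comap_eq_of_isIntegral {R S : Type*} [CommRing R] [CommRing S]
    (f : R →+* S) (hf : f.IsIntegral) {p : PrimeSpectrum R} {q : PrimeSpectrum S}
    (h : PrimeSpectrum.comap f q ≤ p) : ∃ q', PrimeSpectrum.comap f q' = p := by
  algebraize [f]
  obtain ⟨Q, -, hQ, hQp⟩ := Ideal.exists_ideal_over_prime_of_isIntegral p.asIdeal q.asIdeal h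
  exact ⟨⟨Q, hQ⟩, PrimeSpectrum.ext hQp⟩

/-- An integral endomorphism `f` of an irreducible Noetherian ring induces a surjection on spectra.
The images of the generic point under the iterates of `Spec f` form an ascending chain, which would
be strictly ascending if `Spec f` moved the generic point. -/
theorem PrimeSpectrum.comap_surjective_of_isIntegral_endomorphism {S : Type*} [CommRing S]
    [IsNoetherianRing S] (hS : (nilradical S).IsPrime) (f : S →+* S) (hf : f.IsIntegral) :
    Function.Surjective (PrimeSpectrum.comap f) := by
  let η : PrimeSpectrum S := ⟨nilradical S, hS⟩
  have hη : ∀ p, η ≤ p := fun p => nilradical_le_prime p.asIdeal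
  have hmono := PrimeSpectrum.strictMono_comap_of_isIntegral f hf
  have hfix : PrimeSpectrum.comap f η = η := by
    by_contra hne
    have hlt : η < PrimeSpectrum.comap f η := lt_of_le_of_ne (hη _) (Ne.symm hne)
    have hlt' : ∀ n, (PrimeSpectrum.comap f)^[n] η < (PrimeSpectrum.comap f)^[n + 1] η := by
      intro n
      rw [Function.iterate_succ_apply]
      exact hmono.iterate n hlt
    have hs : StrictMono fun n => ((PrimeSpectrum.comap f)^[n] η).asIdeal :=
      strictMono_nat_of_lt_succ hlt'
    obtain ⟨n, hn⟩ := monotone_stabilizes_iff_noetherian.mpr ‹IsNoetherianRing S›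
      ⟨_, hs.monotone⟩
    exact (hs n.lt_succ_self).ne (hn (n + 1) n.le_succ)
  intro p
  exact PrimeSpectrum.exists_comap_eq_of_isIntegral f hf (q := η) (by rw [hfix]; exact hη p)

/-- A connected Noetherian Jacobson scheme whose automorphisms act transitively on the closed points
is irreducible: a general closed point, hence every one, lies on one irreducible component only. -/
theorem isPrime_nilradical_of_transitive {S : Type*} [CommRing S] [IsNoetherianRing S]
    [IsJacobsonRing S] [ConnectedSpace (PrimeSpectrum S)]
    (h : ∀ m m' : Ideal S, m.IsMaximal → m'.IsMaximal → ∃ e : S ≃+* S, m.comap e = m') :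
    (nilradical S).IsPrime := by
  have hfin := minimalPrimes.finite_of_isNoetherianRing S
  obtain ⟨⟨p, hp⟩⟩ : Nonempty (PrimeSpectrum S) := inferInstance
  obtain ⟨P₁, hP₁, -⟩ := Ideal.exists_minimalPrimes_le (bot_le : ⊥ ≤ p)
  have hprime : ∀ {P : Ideal S}, P ∈ minimalPrimes S → P.IsPrime := fun hP => hP.1.1
  have hmin : ∀ {P Q : Ideal S}, P ∈ minimalPrimes S → Q.IsPrime → Q ≤ P → P = Q :=
    fun hP hQ hle => le_antisymm (hP.2 ⟨hQ, bot_le⟩ hle) hle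
  obtain ⟨m, hm, huniq⟩ : ∃ m : Ideal S, m.IsMaximal ∧ ∀ P ∈ minimalPrimes S, P ≤ m → P = P₁ := by
    -- A point of `V(P₁)` at which `a` does not vanish lies on no other component.
    obtain ⟨a, ha, haP⟩ : ∃ a, (∀ P ∈ minimalPrimes S, P ≠ P₁ → a ∈ P) ∧ a ∉ P₁ := by
      by_contra! hcon
      let J := (hfin.toFinset.erase P₁).inf id
      have hJ : J ≤ P₁ := fun a ha => hcon a fun P hP hne =>
        (Finset.inf_le (f := id) (Finset.mem_erase.mpr ⟨hne, hfin.mem_toFinset.mpr hP⟩) : J ≤ P) ha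
      obtain ⟨P, hP, hle⟩ := (Ideal.IsPrime.inf_le' (hprime hP₁)).mp hJ
      rw [Finset.mem_erase, hfin.mem_toFinset] at hP
      exact hP.1 (hmin hP₁ (hprime hP.2) hle).symm
    have hjac : P₁.jacobson = P₁ := IsJacobsonRing.out inferInstance (hprime hP₁).isRadical
    rw [← hjac, Ideal.jacobson, Submodule.mem_sInf] at haP
    push Not at haP
    obtain ⟨m, ⟨-, hm⟩, ham⟩ := haP
    refine ⟨m, hm, fun P hP hle => ?_⟩
    by_contra hne
    exact ham (hle (ha P hP hne))
  have hall : ∀ m' : Ideal S, m'.IsMaximal → ∀ P ∈ minimalPrimes S, ∀ Q ∈ minimalPrimes S,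
      P ≤ m' → Q ≤ m' → P = Q := by
    intro m' hm' P hP Q hQ hPm hQm
    obtain ⟨e, he⟩ := h m' m hm' hm
    have key : ∀ P ∈ minimalPrimes S, P ≤ m' → P.comap e = P₁ := by
      intro P hP hPm
      have := hprime hP
      refine huniq _ ⟨⟨Ideal.comap_isPrime e P, bot_le⟩, ?_⟩ (he ▸ Ideal.comap_mono hPm)
      rintro Q ⟨hQ, -⟩ hle
      have h2 : Q.comap e.symm ≤ P := fun x hx => by
        have := hle hx
        rwa [Ideal.mem_comap, RingEquiv.apply_symm_apply] at this
      have h3 := hP.2 ⟨Ideal.comap_isPrime e.symm Q, bot_le⟩ h2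
      intro x hx
      simpa using h3 hx
    refine Ideal.comap_injective_of_surjective e e.surjective ?_
    rw [key P hP hPm, key Q hQ hQm]
  have hclopen : IsClopen (PrimeSpectrum.zeroLocus (P₁ : Set S)) := by
    refine ⟨PrimeSpectrum.isClosed_zeroLocus _, ?_⟩
    rw [← isClosed_compl_iff]
    have : (PrimeSpectrum.zeroLocus (P₁ : Set S))ᶜ =
        ⋃ P ∈ minimalPrimes S \ {P₁}, PrimeSpectrum.zeroLocus (P : Set S) := by
      ext p
      simp only [Set.mem_compl_iff, PrimeSpectrum.mem_zeroLocus, SetLike.coe_subset_coe,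
        Set.mem_iUnion, exists_prop, Set.mem_sdiff, Set.mem_singleton_iff]
      constructor
      · intro hp
        obtain ⟨P, hP, hle⟩ := Ideal.exists_minimalPrimes_le (bot_le : ⊥ ≤ p.asIdeal)
        exact ⟨P, ⟨hP, fun h => hp (h ▸ hle)⟩, hle⟩
      · rintro ⟨P, ⟨hP, hne⟩, hle⟩ hle₁
        obtain ⟨m', hm', hpm⟩ := Ideal.exists_le_maximal _ p.isPrime.ne_top
        exact hne (hall m' hm' P hP P₁ hP₁ (hle.trans hpm) (hle₁.trans hpm))
    rw [this]
    exact (hfin.subset Set.sdiff_subset).isClosed_biUnion fun P _ =>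
      PrimeSpectrum.isClosed_zeroLocus _
  have huniv := hclopen.eq_univ ⟨⟨P₁, hprime hP₁⟩, fun _ hx => hx⟩
  have : nilradical S = P₁ := by
    apply le_antisymm
    · have := hprime hP₁
      exact nilradical_le_prime P₁
    · rw [nilradical_eq_sInf]
      refine le_sInf fun p hp => ?_
      have : (⟨p, hp⟩ : PrimeSpectrum S) ∈ PrimeSpectrum.zeroLocus (P₁ : Set S) :=
        huniv ▸ Set.mem_univ _
      exact this
  rw [this]
  exact hprime hP₁

/-- Clopen sets have clopen images, so every nonempty one contains the only point above `f x₀`. -/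
theorem ConnectedSpace.of_isOpenMap_isClosedMap {X Y : Type*} [TopologicalSpace X]
    [TopologicalSpace Y] [ConnectedSpace Y] {f : X → Y} (ho : IsOpenMap f) (hc : IsClosedMap f)
    {x₀ : X} (h : ∀ x, f x = f x₀ → x = x₀) : ConnectedSpace X := by
  have key : ∀ s : Set X, IsClopen s → s.Nonempty → x₀ ∈ s := by
    intro s hs hne
    have huniv := IsClopen.eq_univ ⟨hc s hs.1, ho s hs.2⟩ (hne.image f)
    obtain ⟨x, hx, hxx⟩ := huniv ▸ Set.mem_univ (f x₀)
    exact h x hxx ▸ hx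
  have : PreconnectedSpace X := by
    rw [preconnectedSpace_iff_clopen]
    intro s hs
    by_contra! hcon
    have h1 := key s hs hcon.1
    have h2 := key sᶜ hs.compl (Set.nonempty_compl.mpr hcon.2)
    exact h2 h1
  exact ⟨⟨x₀⟩⟩

end CommutativeAlgebra

/-! ### Lang's theorem -/

/-- Local finiteness of the regular representation: `a` lies in the span of finitely many `x j`,
which is stable under the comultiplication. -/
theorem exists_comul_eq_sum.{u, v} {F : Type u} {A : Type v} [Field F] [AddCommGroup A] [Module F A]
    [Coalgebra F A] (a : A) : ∃ (ι : Type v) (_ : Fintype ι) (x : ι → A) (d : ι → ι → A),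
      a ∈ Submodule.span F (Set.range x) ∧
        ∀ k, Coalgebra.comul (R := F) (x k) = ∑ j, x j ⊗ₜ d k j := by
  classical
  let e := Module.Basis.ofVectorSpace F A
  -- `κ i` takes `∑ y i ⊗ e i` to `y i`. The coefficients of `comul a` will serve as the `x j`, by
  -- coassociativity.
  let κ : Module.Basis.ofVectorSpaceIndex F A → A ⊗[F] A →ₗ[F] A := fun i =>
    (TensorProduct.rid F A).toLinearMap ∘ₗ (e.coord i).lTensor A
  have hκ : ∀ i (b c : A), κ i (b ⊗ₜ c) = e.repr c i • b := fun i b c => by simp [κ]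
  obtain ⟨s, hs⟩ : ∃ s : Finset (Module.Basis.ofVectorSpaceIndex F A),
      ∃ y : Module.Basis.ofVectorSpaceIndex F A → A,
        Coalgebra.comul (R := F) a = ∑ i ∈ s, y i ⊗ₜ e i := by
    generalize Coalgebra.comul (R := F) a = t
    obtain ⟨c, rfl⟩ := (TensorProduct.equivFinsuppOfBasisRight (M := A) e).symm.surjective t
    exact ⟨c.support, c, by simp [TensorProduct.equivFinsuppOfBasisRight_symm_apply, Finsupp.sum]⟩
  obtain ⟨y, hy⟩ := hs
  have hyκ : ∀ k ∈ s, κ k (Coalgebra.comul (R := F) a) = y k := by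
    intro k hk
    rw [hy, map_sum, Finset.sum_eq_single k]
    · simp [hκ]
    · intro i _ hik
      simp [hκ, Finsupp.single_eq_of_ne' hik]
    · exact fun h => absurd hk h
  refine ⟨s, inferInstance, fun i => y i, fun k j => κ k (Coalgebra.comul (R := F) (e j)), ?_, ?_⟩
  · have h := congrArg (TensorProduct.rid F A) (Coalgebra.lTensor_counit_comul (R := F) a)
    rw [TensorProduct.rid_tmul, one_smul, hy] at h
    rw [← h, map_sum, map_sum]
    refine Submodule.sum_mem _ fun i hi => ?_
    rw [LinearMap.lTensor_tmul, TensorProduct.rid_tmul]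
    exact Submodule.smul_mem _ _ (Submodule.subset_span ⟨⟨i, hi⟩, rfl⟩)
  · rintro ⟨k, hk⟩
    have h1 : ∀ t : A ⊗[F] A, (κ k).lTensor A (TensorProduct.assoc F A A A
        ((Coalgebra.comul (R := F)).rTensor A t)) = Coalgebra.comul (R := F) (κ k t) := by
      intro t
      induction t with
      | zero => simp
      | add s t hs ht => simp only [map_add, hs, ht]
      | tmul b c =>
        rw [hκ, map_smul, LinearMap.rTensor_tmul]
        generalize Coalgebra.comul (R := F) b = u
        induction u with
        | zero => simp
        | add s t hs ht => simp only [TensorProduct.add_tmul, map_add, smul_add, hs, ht]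
        | tmul p q => simp [hκ]
    change Coalgebra.comul (y k) = _
    rw [← hyκ k hk, ← h1, Coalgebra.coassoc_apply, hy, map_sum, map_sum]
    rw [← Finset.sum_coe_sort s]
    exact Finset.sum_congr rfl fun i _ => by simp

namespace GroupPoints

variable {F A K : Type*} [Field F] [CommRing A] [HopfAlgebra F A] [Field K] [Algebra F K]

theorem ofConv_mul_eq_sum {R : Type*} [CommRing R] [Algebra F R] {ι : Type*} [Fintype ι]
    {x y : ι → A} {a : A} (h : Coalgebra.comul (R := F) a = ∑ j, x j ⊗ₜ y j)
    (g g' : GroupPoints F A R) :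
    (g * g').ofConv a = ∑ j, g.ofConv (x j) * g'.ofConv (y j) := by
  refine (AlgHom.convMul_apply g g' a).trans ?_
  rw [h, map_sum]
  simp

section Components

/-- The identity is the only point of `G_K` above the identity of `G`. -/
theorem ker_lift_le_of_counit (Q : Ideal (K ⊗[F] A))
    (h : ∀ a, Coalgebra.counit (R := F) a = 0 → (1 : K) ⊗ₜ[F] a ∈ Q) :
    RingHom.ker (lift (1 : GroupPoints F A K) : K ⊗[F] A →ₐ[K] K) ≤ Q := by
  have key : ∀ s : K ⊗[F] A, s - algebraMap K _ (lift (1 : GroupPoints F A K) s) ∈ Q := by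
    intro s
    induction s with
    | zero => simp
    | add s t hs ht =>
      rw [map_add, map_add, add_sub_add_comm]
      exact Q.add_mem hs ht
    | tmul k a =>
      have h1 : (k ⊗ₜ[F] a : K ⊗[F] A) -
          algebraMap K _ (lift (1 : GroupPoints F A K) (k ⊗ₜ[F] a)) =
          k ⊗ₜ 1 * (1 ⊗ₜ (a - algebraMap F A (Coalgebra.counit (R := F) a))) := by
        rw [lift_tmul]
        change k ⊗ₜ[F] a - (k * algebraMap F K (Coalgebra.counit (R := F) a)) ⊗ₜ[F] (1 : A) = _
        rw [Algebra.TensorProduct.tmul_mul_tmul, one_mul, mul_one, TensorProduct.tmul_sub,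
          Algebra.algebraMap_eq_smul_one (A := A), TensorProduct.tmul_smul,
          TensorProduct.smul_tmul', Algebra.smul_def, mul_comm k]
      rw [h1]
      refine Q.mul_mem_left _ (h _ ?_)
      simp
  intro s hs
  have := key s
  rwa [(RingHom.mem_ker).mp hs, map_zero, sub_zero] at this

/-- A connected group scheme is geometrically connected, as it has a rational point: over an
algebraic extension of the base field, each component contains the only point above the identity. -/
theorem connectedSpace_baseChange [Algebra.IsAlgebraic F K] [ConnectedSpace (PrimeSpectrum A)] :
    ConnectedSpace (PrimeSpectrum (K ⊗[F] A)) := by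
  let i : A →ₐ[F] K ⊗[F] A := Algebra.TensorProduct.includeRight
  let c := Algebra.TensorProduct.comm F A K
  have hi : (i : A →+* K ⊗[F] A) = (c : A ⊗[F] K →+* K ⊗[F] A).comp (algebraMap A (A ⊗[F] K)) := by
    ext a
    rfl
  have ho : IsOpenMap (PrimeSpectrum.comap (i : A →+* K ⊗[F] A)) := by
    rw [hi, PrimeSpectrum.comap_comp]
    exact PrimeSpectrum.isOpenMap_comap_algebraMap_tensorProduct_of_field.comp
      (PrimeSpectrum.homeomorphOfRingEquiv c.symm.toRingEquiv).isOpenMap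
  have hint : (i : A →+* K ⊗[F] A).IsIntegral := by
    rw [hi]
    refine RingHom.IsIntegral.trans _ _ ?_ (RingHom.isIntegral_of_surjective _ c.surjective)
    exact (algebraMap_isIntegral_iff).mpr inferInstance
  have hmax : (RingHom.ker (lift (1 : GroupPoints F A K) : K ⊗[F] A →ₐ[K] K)).IsMaximal :=
    RingHom.ker_isMaximal_of_surjective _ fun k => ⟨algebraMap K _ k, by simp⟩
  refine ConnectedSpace.of_isOpenMap_isClosedMap ho
    (PrimeSpectrum.isClosedMap_comap_of_isIntegral _ hint) (x₀ := ⟨_, hmax.isPrime⟩) fun Q hQ => ?_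
  refine PrimeSpectrum.ext (hmax.eq_of_le Q.isPrime.ne_top (ker_lift_le_of_counit _ ?_)).symm
  intro a ha
  change a ∈ (PrimeSpectrum.comap (i : A →+* K ⊗[F] A) Q).asIdeal
  rw [hQ]
  change lift (1 : GroupPoints F A K) ((1 : K) ⊗ₜ[F] a) = 0
  rw [lift_tmul, _root_.map_one, one_mul]
  change algebraMap F K (Coalgebra.counit (R := F) a) = 0
  rw [ha, map_zero]

/-- The closed points of a scheme of finite type over an algebraically closed field are
rational. -/
theorem exists_algHom_ker_eq {S : Type*} [CommRing S] [Algebra K S] [IsAlgClosed K]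
    [Algebra.FiniteType K S] (m : Ideal S) (hm : m.IsMaximal) :
    ∃ s : S →ₐ[K] K, RingHom.ker s = m := by
  let _ : Field (S ⧸ m) := Ideal.Quotient.field m
  have := finite_of_finite_type_of_isJacobsonRing K (S ⧸ m)
  let e : K ≃ₐ[K] S ⧸ m :=
    AlgEquiv.ofBijective (Algebra.ofId K _) (IsAlgClosed.algebraMap_bijective_of_isIntegral)
  refine ⟨e.symm.toAlgHom.comp (Ideal.Quotient.mkₐ K m), ?_⟩
  ext x
  simp [RingHom.mem_ker, Ideal.Quotient.eq_zero_iff_mem]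

/-- A connected algebraic group is geometrically irreducible. -/
theorem isPrime_nilradical_baseChange [Algebra.IsAlgebraic F K] [IsAlgClosed K]
    [Algebra.FiniteType F A] [ConnectedSpace (PrimeSpectrum A)] :
    (nilradical (K ⊗[F] A)).IsPrime := by
  have : ConnectedSpace (PrimeSpectrum (K ⊗[F] A)) := connectedSpace_baseChange
  have : IsNoetherianRing (K ⊗[F] A) := Algebra.FiniteType.isNoetherianRing K _
  have : IsJacobsonRing (K ⊗[F] A) := isJacobsonRing_of_finiteType (A := K)
  refine isPrime_nilradical_of_transitive fun m m' hm hm' => ?_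
  obtain ⟨s, rfl⟩ := exists_algHom_ker_eq (K := K) m hm
  obtain ⟨s', rfl⟩ := exists_algHom_ker_eq (K := K) m' hm'
  let g := map (s.restrictScalars F) (generic F A K)
  let g' := map (s'.restrictScalars F) (generic F A K)
  refine ⟨(translation (g' * g⁻¹)).toRingEquiv, ?_⟩
  have h : s.comp (translationHom (g' * g⁻¹)) = s' := by
    rw [comp_translationHom, algHom_eq_lift s']
    congr 1
    have h1 : map (IsScalarTower.toAlgHom F K K) (g' * g⁻¹) = g' * g⁻¹ := ext_ofConv fun _ => rfl
    rw [h1]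
    exact inv_mul_cancel_right g' g
  ext x
  change s (translationHom (g' * g⁻¹) x) = 0 ↔ s' x = 0
  rw [← h]
  rfl

end Components

section Lang

variable (F A K) [Fintype F]

/-- The comorphism of the Lang map `g ↦ g⁻¹ Frob(g)`. -/
def langHom : K ⊗[F] A →ₐ[K] K ⊗[F] A :=
  lift ((generic F A K)⁻¹ * map (FiniteField.frobeniusAlgHom F (K ⊗[F] A)) (generic F A K))

variable {F A K}

theorem langHom_one_tmul (a : A) : langHom F A K (1 ⊗ₜ a) =
    ((generic F A K)⁻¹ *
      map (FiniteField.frobeniusAlgHom F (K ⊗[F] A)) (generic F A K)).ofConv a := by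
  rw [langHom, lift_tmul, _root_.map_one, one_mul]

/-- The Lang map is finite: from `Frob(g) = g * (g⁻¹ Frob(g))`, the `q`-th powers of the matrix
coefficients `x j` are combinations of the `x j`, with coefficients in the image of `langHom`. -/
theorem isIntegral_langHom : (langHom F A K : K ⊗[F] A →+* K ⊗[F] A).IsIntegral := by
  let R := (langHom F A K).range
  have key : ∀ a : A, IsIntegral R ((1 : K) ⊗ₜ[F] a) := by
    intro a
    obtain ⟨ι, _, x, d, ha, hx⟩ := exists_comul_eq_sum (F := F) a
    have hint := isIntegral_of_pow_eq_sum (R := R) Fintype.one_lt_card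
      (fun j => (1 : K) ⊗ₜ[F] x j) (fun k j => ⟨langHom F A K (1 ⊗ₜ d k j), ⟨_, rfl⟩⟩) (by
        intro k
        have h := ofConv_mul_eq_sum (hx k) (generic F A K) ((generic F A K)⁻¹ *
          map (FiniteField.frobeniusAlgHom F (K ⊗[F] A)) (generic F A K))
        rw [mul_inv_cancel_left] at h
        refine h.trans (Finset.sum_congr rfl fun j _ => ?_)
        rw [← langHom_one_tmul, ofConv_generic, mul_comm]
        rfl)
    induction ha using Submodule.span_induction with
    | mem y hy =>
      obtain ⟨j, rfl⟩ := hy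
      exact hint j
    | zero => rw [TensorProduct.tmul_zero]; exact isIntegral_zero
    | add y y' _ _ h h' => rw [TensorProduct.tmul_add]; exact h.add h'
    | smul c y _ h =>
      rw [TensorProduct.tmul_smul]
      exact h.smul c
  have hint : ∀ s : K ⊗[F] A, IsIntegral R s := by
    intro s
    induction s with
    | zero => exact isIntegral_zero
    | add s t hs ht => exact hs.add ht
    | tmul k a =>
      have h : (k ⊗ₜ[F] a : K ⊗[F] A) = k • ((1 : K) ⊗ₜ[F] a) := by simp [TensorProduct.smul_tmul']
      rw [h]
      exact (key a).smul k
  have hcomp : (langHom F A K : K ⊗[F] A →+* K ⊗[F] A) =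
      (algebraMap R (K ⊗[F] A)).comp ((langHom F A K).rangeRestrict : K ⊗[F] A →+* R) := rfl
  rw [hcomp]
  exact RingHom.IsIntegral.trans _ _
    (RingHom.isIntegral_of_surjective _ (langHom F A K).rangeRestrict_surjective) hint

/-- Lang's theorem: every point of `G` is of the form `g⁻¹ Frob(g)`, as a closed point above it for
the Lang map is rational. -/
theorem exists_inv_mul_frobenius_eq [Algebra.IsAlgebraic F K] [IsAlgClosed K]
    [Algebra.FiniteType F A] [ConnectedSpace (PrimeSpectrum A)] (b : GroupPoints F A K) :
    ∃ g : GroupPoints F A K, g⁻¹ * map (FiniteField.frobeniusAlgHom F K) g = b := by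
  have : IsNoetherianRing (K ⊗[F] A) := Algebra.FiniteType.isNoetherianRing K _
  have hmax : (RingHom.ker (lift b : K ⊗[F] A →ₐ[K] K)).IsMaximal :=
    RingHom.ker_isMaximal_of_surjective _ fun k => ⟨algebraMap K _ k, by simp⟩
  obtain ⟨⟨P, hP⟩, hPb⟩ := PrimeSpectrum.comap_surjective_of_isIntegral_endomorphism
    (isPrime_nilradical_baseChange (F := F) (A := A) (K := K)) _ isIntegral_langHom
    ⟨_, hmax.isPrime⟩
  have hPb' : P.comap (langHom F A K : K ⊗[F] A →+* K ⊗[F] A) = RingHom.ker (lift b) :=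
    congrArg PrimeSpectrum.asIdeal hPb
  have hPmax : P.IsMaximal :=
    Ideal.isMaximal_of_isIntegral_of_isMaximal_comap' _ isIntegral_langHom P (hPb' ▸ hmax)
  obtain ⟨s, rfl⟩ := exists_algHom_ker_eq (K := K) P hPmax
  have hs : s.comp (langHom F A K) = lift b := by
    ext a
    let x : K ⊗[F] A := 1 ⊗ₜ a - algebraMap K _ (lift b ((1 : K) ⊗ₜ[F] a))
    have hx : x ∈ RingHom.ker (lift b : K ⊗[F] A →ₐ[K] K) := by simp [x, RingHom.mem_ker]
    rw [← hPb'] at hx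
    have hx' : s (langHom F A K x) = 0 := hx
    rw [map_sub, map_sub, AlgHom.commutes, AlgHom.commutes, sub_eq_zero] at hx'
    exact hx'
  refine ⟨map (s.restrictScalars F) (generic F A K), ext_ofConv fun a => ?_⟩
  have h1 : map (FiniteField.frobeniusAlgHom F K) (map (s.restrictScalars F) (generic F A K)) =
      map (s.restrictScalars F)
        (map (FiniteField.frobeniusAlgHom F (K ⊗[F] A)) (generic F A K)) :=
    ext_ofConv fun a => (map_pow s _ _).symm
  rw [h1, ← map_inv, ← _root_.map_mul, ofConv_map, ← langHom_one_tmul]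
  refine (AlgHom.congr_fun hs (1 ⊗ₜ a)).trans ?_
  simp

end Lang

end GroupPoints

/-! ### Cohomology -/

section Continuity

variable {F A K : Type*} [Field F] [CommRing A] [HopfAlgebra F A] [Field K] [Algebra F K]
  [Algebra.IsAlgebraic F K]

open scoped Topology in
theorem GroupPoints.isLocallyConstant_smul [Algebra.FiniteType F A] (g : GroupPoints F A K) :
    IsLocallyConstant fun σ : K ≃ₐ[F] K => σ • g := by
  have h1 : {σ : K ≃ₐ[F] K | σ • g = g} ∈ 𝓝 1 := by
    obtain ⟨s, hs⟩ := Algebra.FiniteType.out (R := F) (A := A)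
    have h : ⋂ a ∈ s, {σ : K ≃ₐ[F] K | σ (g.ofConv a) = g.ofConv a} ∈ 𝓝 1 :=
      (Filter.biInter_finset_mem s).mpr fun a _ => AlgEquiv.setOf_apply_eq_mem_nhds_one _
    filter_upwards [h] with σ hσ
    apply WithConv.ofConv_injective
    refine AlgHom.ext_of_adjoin_eq_top hs fun a ha => ?_
    exact Set.mem_iInter₂.mp hσ a ha
  rw [IsLocallyConstant.iff_eventually_eq]
  intro σ
  have hc : Filter.Tendsto (fun τ => σ⁻¹ * τ) (𝓝 σ) (𝓝 (1 : K ≃ₐ[F] K)) :=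
    (continuous_const_mul σ⁻¹).tendsto' _ _ (inv_mul_cancel σ)
  filter_upwards [hc h1] with τ hτ
  have hτ' : (σ⁻¹ * τ) • g = g := hτ
  rw [mul_smul, inv_smul_eq_iff] at hτ'
  exact hτ'

open scoped Topology in
/-- The Frobenius automorphism generates a dense subgroup of the Galois group of a finite field. -/
theorem exists_frobenius_pow_mem [Fintype F] {N : Set (K ≃ₐ[F] K)} {σ : K ≃ₐ[F] K} (hN : N ∈ 𝓝 σ) :
    ∃ n : ℕ, FiniteField.frobeniusAlgEquivOfAlgebraic F K ^ n ∈ N := by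
  have hc : Filter.Tendsto (fun τ => σ * τ) (𝓝 (1 : K ≃ₐ[F] K)) (𝓝 σ) :=
    (continuous_const_mul σ).tendsto' _ _ (mul_one σ)
  obtain ⟨E, hE, hEN⟩ := (krullTopology_mem_nhds_one_iff F K _).mp (hc hN)
  have : Finite E := Module.finite_of_finite F
  obtain ⟨n, hn⟩ := (FiniteField.bijective_frobeniusAlgEquivOfAlgebraic_pow F E).2
    (σ.restrictNormal E)
  refine ⟨n, ?_⟩
  rw [← mul_inv_cancel_left σ (FiniteField.frobeniusAlgEquivOfAlgebraic F K ^ (n : ℕ))]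
  refine hEN ?_
  rw [SetLike.mem_coe, IntermediateField.mem_fixingSubgroup_iff]
  intro c hc
  change σ.symm ((FiniteField.frobeniusAlgEquivOfAlgebraic F K ^ (n : ℕ)) c) = c
  rw [AlgEquiv.symm_apply_eq]
  have h := σ.restrictNormal_commutes E ⟨c, hc⟩
  rw [← hn] at h
  refine Eq.trans ?_ h
  simp only [AlgEquiv.coe_pow, FiniteField.coe_frobeniusAlgEquivOfAlgebraic_iterate]
  rfl

/-- Lang's theorem, in terms of cohomology: a cocycle that is trivial at the Frobenius automorphism
is trivial on its powers, which are dense. -/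
theorem exists_inv_mul_smul_eq_of_finite [Finite F] [IsAlgClosed K] [Algebra.FiniteType F A]
    [ConnectedSpace (PrimeSpectrum A)] (z : OneCocycle (K ≃ₐ[F] K) (GroupPoints F A K)) :
    ∃ g : GroupPoints F A K, ∀ σ, z.toFun σ = g⁻¹ * σ • g := by
  have := Fintype.ofFinite F
  let Φ := FiniteField.frobeniusAlgEquivOfAlgebraic F K
  obtain ⟨g, hg⟩ := GroupPoints.exists_inv_mul_frobenius_eq (z.toFun Φ)
  have hg' : z.toFun Φ = g⁻¹ * Φ • g := hg.symm
  have hpow : ∀ n : ℕ, z.toFun (Φ ^ n) = g⁻¹ * (Φ ^ n) • g := by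
    intro n
    induction n with
    | zero =>
      have h1 : z.toFun 1 = 1 := by simpa using z.map_mul 1 1
      simp [h1]
    | succ n ih =>
      rw [pow_succ, z.map_mul, ih, hg', smul_mul', smul_inv', mul_smul]
      group
  refine ⟨g, fun σ => ?_⟩
  obtain ⟨n, hn, hn'⟩ := exists_frobenius_pow_mem ((z.isLocallyConstant.eventually_eq σ).and
    (g.isLocallyConstant_smul.eventually_eq σ))
  rw [← hn, ← hn']
  exact hpow n

theorem SeparableClosure.isAlgClosed (F : Type*) [Field F] [PerfectField F] :
    IsAlgClosed (SeparableClosure F) :=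
  have : PerfectField (SeparableClosure F) := Algebra.IsAlgebraic.perfectField (K := F)
  IsSepClosed.isAlgClosed_of_perfectField _

end Continuity

namespace GroupRep

variable {F A V : Type*} [Field F] [CommRing A] [HopfAlgebra F A]
  [AddCommGroup V] [Module F V] (ρ : GroupRep F A V)

/-- The class of a cocycle comes from `H` if a cohomologous cocycle takes its values in `H`. -/
theorem exists_stabilizerH1Map_eq [Algebra.FiniteType F A] (x : ℙ F V)
    (z : OneCocycle (SeparableClosure F ≃ₐ[F] SeparableClosure F)
      (GroupPoints F A (SeparableClosure F)))
    (g : GroupPoints F A (SeparableClosure F))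
    (h : ∀ σ, g⁻¹ * z.toFun σ * σ • g ∈ ρ.stabilizer x (SeparableClosure F)) :
    ∃ c, ρ.stabilizerH1Map x c = Quotient.mk _ z := by
  let w : OneCocycle (SeparableClosure F ≃ₐ[F] SeparableClosure F)
      (ρ.stabilizer x (SeparableClosure F)) :=
    { toFun := fun σ => ⟨_, h σ⟩
      isLocallyConstant := by
        have h1 : IsLocallyConstant fun σ : SeparableClosure F ≃ₐ[F] SeparableClosure F =>
            g⁻¹ * z.toFun σ * σ • g :=
          (z.isLocallyConstant.prodMk g.isLocallyConstant_smul).comp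
            fun p : GroupPoints F A (SeparableClosure F) × GroupPoints F A (SeparableClosure F) =>
              g⁻¹ * p.1 * p.2
        exact IsLocallyConstant.desc _ (Subtype.val) h1 Subtype.val_injective
      map_mul := fun σ τ => by
        apply Subtype.ext
        change g⁻¹ * z.toFun (σ * τ) * (σ * τ) • g =
          (g⁻¹ * z.toFun σ * σ • g) * σ • (g⁻¹ * z.toFun τ * τ • g)
        rw [z.map_mul, smul_mul', smul_mul', smul_inv', mul_smul]
        group }
  refine ⟨Quotient.mk _ w, Quotient.sound ⟨g⁻¹, fun σ => ?_⟩⟩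
  change z.toFun σ = g⁻¹⁻¹ * (g⁻¹ * z.toFun σ * σ • g) * σ • g⁻¹
  rw [smul_inv']
  group

/-- If `g` takes `x` to a point fixed by the action twisted by `z`, then `g⁻¹ z_σ σ(g)` fixes
`x`. -/
theorem twisted_mem_stabilizer {K : Type*} [Field K] [Algebra F K] {v : V} (hv : v ≠ 0)
    (z : OneCocycle (K ≃ₐ[F] K) (GroupPoints F A K)) {y : K ⊗[F] V}
    (hy : ∀ σ, ρ.twistedAction z σ y = y) {g : GroupPoints F A K} {d : K}
    (hg : ρ.actOn g v = d • y) (σ : K ≃ₐ[F] K) :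
    g⁻¹ * z.toFun σ * σ • g ∈ ρ.stabilizer (Projectivization.mk F v hv) K := by
  have hact : ∀ g : GroupPoints F A K, ρ.actOn g v = ρ.act g ((1 : K) ⊗ₜ v) := fun g => by
    rw [act_tmul, one_smul]
  have hinv : d • ρ.act g⁻¹ y = (1 : K) ⊗ₜ[F] v := by
    rw [← map_smul, ← hg, hact, ← Module.End.mul_apply, ← act_mul, inv_mul_cancel, act_one,
      Module.End.one_apply]
  have hd : d ≠ 0 := by
    rintro rfl
    rw [zero_smul] at hinv
    exact hv (Module.FaithfullyFlat.tensorProduct_mk_injective (A := F) (B := K) V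
      (by simpa using hinv.symm))
  rw [mem_stabilizer_mk]
  -- `g` takes `v` to `d • y`, `σ(g)` takes `v` to `σ d • σ(y)`, and `z_σ` takes `σ(y)` to `y`.
  refine ⟨σ d * d⁻¹, ?_⟩
  have hσ := hy σ
  rw [twistedAction_apply] at hσ
  rw [hact, act_mul, act_mul, Module.End.mul_apply, Module.End.mul_apply, ← hact, actOn_smul, hg,
    rTensor_smul, map_smul, hσ, map_smul, ← hinv, smul_smul, mul_assoc, inv_mul_cancel₀ hd, mul_one]

theorem repr_rTensor {K L ι : Type*} [Field K] [Algebra F K] [Field L] [Algebra F L]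
    (b : Module.Basis ι F V) (f : K →ₐ[F] L) (y : K ⊗[F] V) (i : ι) :
    (b.baseChange L).repr (f.toLinearMap.rTensor V y) i = f ((b.baseChange K).repr y i) := by
  induction y with
  | zero => simp
  | add s t hs ht => simp only [map_add, Finsupp.add_apply, hs, ht]
  | tmul k v => simp [Algebra.smul_def]

/-- A point of the orbit of `x` that is defined over the separable closure is conjugate to `x` over
the separable closure. -/
theorem exists_actOn_eq [FiniteDimensional F V] {v : V} (hv : v ≠ 0)
    (hH : PerfectField F ∨
      Algebra.Smooth F (A ⧸ ρ.stabilizerIdeal (Projectivization.mk F v hv)))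
    {y : SeparableClosure F ⊗[F] V} (hy : y ≠ 0) {g : GroupPoints F A (AlgebraicClosure F)}
    {c : AlgebraicClosure F}
    (hg : ρ.actOn g v = c • (IsScalarTower.toAlgHom F (SeparableClosure F)
      (AlgebraicClosure F)).toLinearMap.rTensor V y) :
    ∃ (h : GroupPoints F A (SeparableClosure F)) (d : SeparableClosure F),
      ρ.actOn h v = d • y := by
  let b := Module.finBasis F V
  let y' := (b.baseChange (SeparableClosure F)).repr y
  have hg' : ∀ i, g.ofConv (ρ.coeff b i v) =
      c * algebraMap (SeparableClosure F) (AlgebraicClosure F) (y' i) := by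
    intro i
    rw [← repr_actOn, hg, map_smul, Finsupp.smul_apply, repr_rTensor]
    rfl
  suffices h : ∃ (h : GroupPoints F A (SeparableClosure F)) (d : SeparableClosure F),
      ∀ i, h.ofConv (ρ.coeff b i v) = d * y' i by
    obtain ⟨h, d, hd⟩ := h
    refine ⟨h, d, (b.baseChange (SeparableClosure F)).ext_elem fun i => ?_⟩
    rw [repr_actOn, hd, map_smul]
    rfl
  obtain hF | hH := hH
  · have := SeparableClosure.isAlgClosed F
    let e : SeparableClosure F ≃ₐ[F] AlgebraicClosure F :=
      AlgEquiv.ofBijective (IsScalarTower.toAlgHom F _ _)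
        (IsAlgClosed.algebraMap_bijective_of_isIntegral)
    refine ⟨GroupPoints.map e.symm.toAlgHom g, e.symm c, fun i => ?_⟩
    change e.symm (g.ofConv _) = _
    rw [hg', map_mul]
    congr 1
    exact e.symm_apply_apply (y' i)
  · refine exists_point_transporter ρ b hv ?_ g hg'
    by_contra! h
    exact hy ((b.baseChange _).ext_elem (by simpa using h))

/-- Over an infinite field, the twist of `V` by a cocycle has a rational point in the open orbit. -/
theorem exists_fixed_mem_openOrbit [Infinite F] [FiniteDimensional F V]
    {U : Set (ℙ (AlgebraicClosure F) (AlgebraicClosure F ⊗[F] V))} (hU : ρ.IsOpenOrbit U)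
    {v : V} (hv : v ≠ 0)
    (hx : projBaseChange (AlgebraicClosure F) (Projectivization.mk F v hv) ∈ U)
    (z : OneCocycle (SeparableClosure F ≃ₐ[F] SeparableClosure F)
      (GroupPoints F A (SeparableClosure F))) :
    ∃ y : SeparableClosure F ⊗[F] V, y ≠ 0 ∧ (∀ σ, ρ.twistedAction z σ y = y) ∧
      ∃ (g : GroupPoints F A (AlgebraicClosure F)) (c : AlgebraicClosure F),
        ρ.actOn g v = c • (IsScalarTower.toAlgHom F (SeparableClosure F)
          (AlgebraicClosure F)).toLinearMap.rTensor V y := by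
  obtain ⟨⟨p, hp⟩, hopen⟩ := hU
  let j := (IsScalarTower.toAlgHom F (SeparableClosure F)
    (AlgebraicClosure F)).toLinearMap.rTensor V
  have hj : ∀ (c : SeparableClosure F) (w : SeparableClosure F ⊗[F] V),
      j (c • w) = algebraMap _ (AlgebraicClosure F) c • j w := by
    intro c w
    induction w with
    | zero => simp
    | add s t hs ht => simp only [smul_add, map_add, hs, ht]
    | tmul k v => simp [j, TensorProduct.smul_tmul']
  let D₀ : Submodule F (SeparableClosure F ⊗[F] V) :=
    ⨅ σ, LinearMap.eqLocus (ρ.twistedAction z σ) LinearMap.id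
  have hD₀ : ∀ w, w ∈ D₀ ↔ ∀ σ, ρ.twistedAction z σ w = w := fun w => by
    simp [D₀, Submodule.mem_iInf]
  have hspan : Submodule.span (AlgebraicClosure F) (D₀.map j : Set (AlgebraicClosure F ⊗[F] V)) =
      ⊤ := by
    rw [eq_top_iff]
    rintro t -
    induction t with
    | zero => exact Submodule.zero_mem _
    | add s t hs ht => exact Submodule.add_mem _ hs ht
    | tmul k v =>
      have h1 : k ⊗ₜ[F] v = k • j (1 ⊗ₜ v) := by simp [j, TensorProduct.smul_tmul']
      rw [h1]
      refine Submodule.smul_mem _ _ ?_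
      have h2 : (1 : SeparableClosure F) ⊗ₜ[F] v ∈
          Submodule.span (SeparableClosure F) {w | ∀ σ, ρ.twistedAction z σ w = w} :=
        ρ.span_twistedAction_fixedPoints z ▸ Submodule.mem_top
      generalize (1 : SeparableClosure F) ⊗ₜ[F] v = w at h2
      induction h2 using Submodule.span_induction with
      | mem w hw => exact Submodule.subset_span ⟨w, (hD₀ w).mpr hw, rfl⟩
      | zero => rw [map_zero]; exact Submodule.zero_mem _
      | add s t _ _ hs ht => rw [map_add]; exact Submodule.add_mem _ hs ht
      | smul c w _ h => rw [hj]; exact Submodule.smul_mem _ _ h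
  obtain ⟨_, ⟨y, hy, rfl⟩, hy0, hyU⟩ := hopen.exists_mk_mem ⟨_, hx⟩ _ hspan
  refine ⟨y, fun h => hy0 (by rw [h, map_zero]), (hD₀ y).mp hy, ?_⟩
  rw [hp] at hx hyU
  obtain ⟨g₁, hg₁⟩ := hx
  obtain ⟨g₂, hg₂⟩ := hyU
  have h0 : (1 : AlgebraicClosure F) ⊗ₜ[F] v ≠ 0 := fun h => hv
    (Module.FaithfullyFlat.tensorProduct_mk_injective (A := F) (B := AlgebraicClosure F) V
      (by simpa using h))
  have h1 : projBaseChange (AlgebraicClosure F) (Projectivization.mk F v hv) =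
    Projectivization.mk (AlgebraicClosure F) _ h0 := rfl
  have h2 : ρ.toGL (g₂ * g₁⁻¹) • Projectivization.mk (AlgebraicClosure F) _ h0 =
      Projectivization.mk (AlgebraicClosure F) _ hy0 := by
    rw [← h1, ← hg₁, ← hg₂, map_mul, map_inv, mul_smul, inv_smul_smul]
  rw [Projectivization.smul_mk, Projectivization.mk_eq_mk_iff'] at h2
  obtain ⟨c, hc⟩ := h2
  refine ⟨g₂ * g₁⁻¹, c, ?_⟩
  refine Eq.trans ?_ hc.symm
  change _ = ρ.act (g₂ * g₁⁻¹) ((1 : AlgebraicClosure F) ⊗ₜ v)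
  rw [act_tmul, one_smul]

end GroupRep

end

/-- `G = Spec A` is a (smooth, affine) algebraic group over `F`, and `V` a representation of it with
an open orbit `U` in `ℙ(V)`. -/
theorem mainTheorem12 {F A V : Type*} [Field F] [CommRing A] [HopfAlgebra F A]
    [Algebra.Smooth F A] [AddCommGroup V] [Module F V] [FiniteDimensional F V]
    (hFG : Infinite F ∨ ConnectedSpace (PrimeSpectrum A))
    (ρ : GroupRep F A V)
    (U : Set (ℙ (AlgebraicClosure F) (AlgebraicClosure F ⊗[F] V))) (hU : ρ.IsOpenOrbit U)
    (x : ℙ F V) (hx : projBaseChange (AlgebraicClosure F) x ∈ U)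
    (hH : PerfectField F ∨ Algebra.Smooth F (A ⧸ ρ.stabilizerIdeal x)) :
    Function.Surjective (ρ.stabilizerH1Map x) := by
  intro c
  obtain ⟨z, rfl⟩ := Quotient.exists_rep c
  obtain ⟨g, hg⟩ : ∃ g : GroupPoints F A (SeparableClosure F),
      ∀ σ, g⁻¹ * z.toFun σ * σ • g ∈ ρ.stabilizer x (SeparableClosure F) := by
    induction x using Projectivization.ind with
    | h v hv =>
      obtain hF | hF := finite_or_infinite F
      · have hA : ConnectedSpace (PrimeSpectrum A) :=
          hFG.resolve_left (not_infinite_iff_finite.mpr hF)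
        have := SeparableClosure.isAlgClosed F
        obtain ⟨g, hg⟩ := exists_inv_mul_smul_eq_of_finite z
        refine ⟨g⁻¹, fun σ => ?_⟩
        have h1 : g⁻¹⁻¹ * z.toFun σ * σ • g⁻¹ = 1 := by
          rw [hg, smul_inv']
          group
        rw [h1]
        exact Subgroup.one_mem _
      · obtain ⟨y, hy0, hy, g₀, c, hg₀⟩ := ρ.exists_fixed_mem_openOrbit hU hv hx z
        obtain ⟨g, d, hg⟩ := ρ.exists_actOn_eq hv hH hy0 hg₀
        exact ⟨g, ρ.twisted_mem_stabilizer hv z hy hg⟩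
  exact ρ.exists_stabilizerH1Map_eq x z g hg
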